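/- Let $G$ be a real, connected, compact, semisimple (finite-dimensional, smooth) Lie group with Lie algebra $\mathfrak g$. A smooth vector field $\mathcal X$ on $G$ is called linear if it has a global flow $(\varphi_t)_{t\in\mathbb R}$ and each $\varphi_t$ is an automorphism of the Lie group $G$. Let $\mathcal X$ be a linear vector field on $G$ with flow $\varphi_t$, and let $\mathcal D$ be the associated derivation of $\mathfrak g$, $\mathcal D(Y)=-[\mathcal X,Y]$, where $Y\in\mathfrak g$ is regarded as an invariant vector field on $G$. Suppose that there is $\alpha\in\mathbb R$ such that every complex eigenvalue of $\mathcal D$ belongs to $\{0,\alpha i,-\alpha i\}$. Let $g\in G$ and let $$\Omega=\bigcap_{s\in\mathbb R}\overline{\{\varphi_t(g): t\ge s\}}$$ be the $\omega$-limit set of $g$. If $\Omega$ is nonempty and compact and contains no fixed point of the flow (no $x$ with $\varphi_t(x)=x$ for all $t$), then $\Omega$ is a periodic orbit: there is $x\in G$, not a fixed point, and $T>0$ such that $\varphi_{t+T}(x)=\varphi_t(x)$ for all $t\in\mathbb R$ and $\Omega=\{\varphi_t(x):t\in\mathbb R\}$. -/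

import Mathlib

open scoped Manifold ContDiff TensorProduct

/-- Over `ℝ` the smoothness index used for the Lie algebra of a Lie group is `3 ≤ ∞`, so that the
Lie algebra of a smooth Lie group is available. -/
instance LinearFlow.instLEInfty : ENat.LEInfty (minSmoothness ℝ 3) :=
  ⟨by rw [minSmoothness_of_isRCLikeNormedField]; exact ENat.LEInfty.out⟩

namespace LinearFlow

section Flows

variable {E : Type*} [NormedAddCommGroup E] [NormedSpace ℝ E]
  {H : Type*} [TopologicalSpace H] (I : ModelWithCorners ℝ E H)
  {G : Type*} [TopologicalSpace G] [ChartedSpace H G]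

/-- `φ` is the (globally defined) flow of the vector field `X`: for every `g`, the curve
`t ↦ φ t g` is the integral curve of `X` through `g` at time `0`. -/
structure IsFlowOf (X : (g : G) → TangentSpace I g) (φ : ℝ → G → G) : Prop where
  zero_apply : ∀ g : G, φ 0 g = g
  isMIntegralCurve : ∀ g : G, IsMIntegralCurve (I := I) (fun t : ℝ => φ t g) X

/-- `f` is an automorphism of the Lie group `G`: a group automorphism that is smooth together
with its inverse. -/
def IsLieGroupAutomorphism [Group G] (f : G → G) : Prop :=
  ∃ e : G ≃* G, (∀ g, e g = f g) ∧ ContMDiff I I ∞ (fun g => e g) ∧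
    ContMDiff I I ∞ (fun g => e.symm g)

/-- A smooth vector field on a Lie group is *linear* if it has a global flow consisting of
automorphisms of the Lie group. -/
structure IsLinearVectorField [Group G] [IsManifold I ∞ G]
    (X : (g : G) → TangentSpace I g) : Prop where
  contMDiff : ContMDiff I I.tangent ∞ (fun g => (⟨g, X g⟩ : TangentBundle I G))
  exists_flow : ∃ φ : ℝ → G → G, IsFlowOf I X φ ∧ ∀ t, IsLieGroupAutomorphism I (φ t)

end Flows

section Derivation

variable {E : Type*} [NormedAddCommGroup E] [NormedSpace ℝ E] [CompleteSpace E]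
  {H : Type*} [TopologicalSpace H] (I : ModelWithCorners ℝ E H)
  {G : Type*} [TopologicalSpace G] [ChartedSpace H G] [Group G] [LieGroup I ∞ G]

/-- The map `𝒟 Y = -[X, Y]` of the Lie algebra of `G` associated with a vector field `X`, where an
element `Y` of the Lie algebra is identified with its invariant vector field, and the value of the
bracket at the identity is taken. For a linear vector field `X` this is a derivation. -/
noncomputable def derivationOf (X : (g : G) → TangentSpace I g) :
    GroupLieAlgebra I G →ₗ[ℝ] GroupLieAlgebra I G where
  toFun Y := -VectorField.mlieBracket I X (mulInvariantVectorField Y) (1 : G)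
  map_add' Y Z := by
    rw [mulInvariantVectorField_add, VectorField.mlieBracket_add_right, neg_add]
    · exact mdifferentiableAt_mulInvariantVectorField _
    · exact mdifferentiableAt_mulInvariantVectorField _
  map_smul' c Y := by
    rw [mulInvariantVectorField_smul, VectorField.mlieBracket_const_smul_right, RingHom.id_apply,
      smul_neg]
    exact mdifferentiableAt_mulInvariantVectorField _

/-- A Lie group is *semisimple* if its Lie algebra is semisimple. -/
def IsSemisimpleLieGroup (G : Type*) [TopologicalSpace G] [ChartedSpace H G] [Group G]
    [LieGroup I ∞ G] : Prop :=
  LieAlgebra.IsSemisimple ℝ (GroupLieAlgebra I G)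

end Derivation

/-- `μ` is a complex eigenvalue of the real endomorphism `D`, that is, an eigenvalue of the
complexification of `D`. -/
def IsComplexEigenvalue {V : Type*} [AddCommGroup V] [Module ℝ V] (D : V →ₗ[ℝ] V) (μ : ℂ) : Prop :=
  Module.End.HasEigenvalue (LinearMap.baseChange ℂ D : Module.End ℂ (ℂ ⊗[ℝ] V)) μ

section Orbits

variable {M : Type*} (φ : ℝ → M → M)

/-- `x` is a fixed point of the flow `φ`. -/
def IsFixedPoint (x : M) : Prop := ∀ t : ℝ, φ t x = x

/-- `Γ` is a periodic orbit of the flow `φ`: the orbit of a point which is not fixed and which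
returns after some positive time. -/
def IsPeriodicOrbit (Γ : Set M) : Prop :=
  ∃ x : M, ¬ IsFixedPoint φ x ∧ (∃ T : ℝ, 0 < T ∧ Function.Periodic (fun t => φ t x) T) ∧
    Γ = Set.range (fun t : ℝ => φ t x)

end Orbits

end LinearFlow

namespace LinearFlow
open Set Filter Topology

section Chart

variable {E : Type*} [NormedAddCommGroup E] [NormedSpace ℝ E]
  {H : Type*} [TopologicalSpace H] (I : ModelWithCorners ℝ E H)
  {M : Type*} [TopologicalSpace M] [ChartedSpace H M]
  {F : Type*} [NormedAddCommGroup F] [NormedSpace ℝ F]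

theorem contDiffAt_extChartAt_comp [IsManifold I ∞ M] {p : M} {w : F → M} {z : F}
    (hw : ContMDiffAt 𝓘(ℝ, F) I ∞ w z) (hs : w z ∈ (extChartAt I p).source) :
    ContDiffAt ℝ ∞ (fun y => extChartAt I p (w y)) z := by
  rw [← contMDiffAt_iff_contDiffAt]
  exact (contMDiffAt_extChartAt' (by simpa using hs)).comp z hw

theorem extChartAt_target_mem_nhds_of_mem [IsManifold I ∞ M] [BoundarylessManifold I M] {p : M}
    {y : E} (hy : y ∈ (extChartAt I p).target) : (extChartAt I p).target ∈ 𝓝 y := by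
  have hs := (extChartAt I p).map_target hy
  have h := (ModelWithCorners.isInteriorPoint_iff_of_mem_atlas (I := I) (n := ∞) (by simp)
    (chart_mem_atlas H p) (by simpa using hs)).1
    (BoundarylessManifold.isInteriorPoint' ((extChartAt I p).symm y))
  change extChartAt I p _ ∈ interior (extChartAt I p).target at h
  rw [(extChartAt I p).right_inv hy] at h
  exact mem_interior_iff_mem_nhds.1 h

theorem contMDiffAt_extChartAt_symm_comp [IsManifold I ∞ M] [BoundarylessManifold I M] {p : M}
    {u : F → E} {z : F} (hu : ContDiffAt ℝ ∞ u z) (ht : u z ∈ (extChartAt I p).target) :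
    ContMDiffAt 𝓘(ℝ, F) I ∞ (fun y => (extChartAt I p).symm (u y)) z :=
  ((contMDiffOn_extChartAt_symm p).contMDiffAt (extChartAt_target_mem_nhds_of_mem I ht)).comp z
    hu.contMDiffAt

theorem range_mem_nhds_extChartAt [IsManifold I ∞ M] [BoundarylessManifold I M] {p : M} {y : E}
    (hy : y ∈ (extChartAt I p).target) : range I ∈ 𝓝 y :=
  mem_of_superset (extChartAt_target_mem_nhds_of_mem I hy) (extChartAt_target_subset_range p)

theorem mfderiv_eq_fderiv_chart [IsManifold I ∞ M] [BoundarylessManifold I M] {p : M} {f : M → F}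
    (hf : MDifferentiableAt I 𝓘(ℝ, F) f p) :
    mfderiv I 𝓘(ℝ, F) f p = fderiv ℝ (f ∘ (extChartAt I p).symm) (extChartAt I p p) := by
  refine (if_pos hf).trans ?_
  exact fderivWithin_of_mem_nhds (range_mem_nhds_extChartAt I (mem_extChartAt_target p))

/-- The expression of a vector field in the preferred chart at `p`. -/
noncomputable def chartField (p : M) (V : (x : M) → TangentSpace I x) (y : E) : E :=
  mfderiv I 𝓘(ℝ, E) (extChartAt I p) ((extChartAt I p).symm y) (V ((extChartAt I p).symm y))

theorem chartField_self [IsManifold I ∞ M] [BoundarylessManifold I M] (p : M)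
    (V : (x : M) → TangentSpace I x) : chartField I p V (extChartAt I p p) = V p := by
  have : IsManifold I 1 M := IsManifold.of_le (n := ∞) (by simp)
  have h := mfderiv_extChartAt_self (I := I) (x := p)
  rw [chartField, extChartAt_to_inv, h]
  rfl

theorem mpullbackWithin_eq_chartField [IsManifold I ∞ M] [BoundarylessManifold I M] {p : M}
    (V : (x : M) → TangentSpace I x) {y : E} (hy : y ∈ (extChartAt I p).target) :
    VectorField.mpullbackWithin 𝓘(ℝ, E) I (extChartAt I p).symm V (range I) y =
      chartField I p V y := by
  have : IsManifold I 1 M := IsManifold.of_le (n := ∞) (by simp)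
  rw [VectorField.mpullbackWithin_apply, chartField]
  congr 1
  exact ContinuousLinearMap.inverse_eq
    (mfderivWithin_extChartAt_symm_comp_mfderiv_extChartAt hy)
    (mfderiv_extChartAt_comp_mfderivWithin_extChartAt_symm hy)

theorem differentiableAt_chartField [CompleteSpace E] [IsManifold I ∞ M] [BoundarylessManifold I M]
    {p : M} {V : (x : M) → TangentSpace I x}
    (hV : MDifferentiableAt I I.tangent (fun x => (⟨x, V x⟩ : TangentBundle I M)) p) :
    DifferentiableAt ℝ (chartField I p V) (extChartAt I p p) := by
  have : IsManifold I 2 M := IsManifold.of_le (n := ∞) (by norm_cast)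
  have h := (hV.mdifferentiableWithinAt
    (s := univ)).differentiableWithinAt_mpullbackWithin_vectorField
  rw [preimage_univ, univ_inter] at h
  refine (h.differentiableAt (range_mem_nhds_extChartAt I (mem_extChartAt_target p))).congr_of_eventuallyEq
    ?_
  filter_upwards [extChartAt_target_mem_nhds_of_mem I (mem_extChartAt_target p)] with y hy
  exact (mpullbackWithin_eq_chartField I V hy).symm

theorem mlieBracket_eq_chartField [IsManifold I ∞ M] [BoundarylessManifold I M] (p : M)
    (V W : (x : M) → TangentSpace I x) :
    VectorField.mlieBracket I V W p =
      fderiv ℝ (chartField I p W) (extChartAt I p p) (V p) -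
        fderiv ℝ (chartField I p V) (extChartAt I p p) (W p) := by
  have hn := extChartAt_target_mem_nhds_of_mem I (mem_extChartAt_target (I := I) p)
  have e (U : (x : M) → TangentSpace I x) :
      VectorField.mpullbackWithin 𝓘(ℝ, E) I (extChartAt I p).symm U (range I)
        =ᶠ[𝓝 (extChartAt I p p)] chartField I p U := by
    filter_upwards [hn] with y hy using mpullbackWithin_eq_chartField I U hy
  have : IsManifold I 1 M := IsManifold.of_le (n := ∞) (by simp)
  have h1 := mfderiv_extChartAt_self (I := I) (x := p)
  have key : VectorField.lieBracketWithin ℝ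
      (VectorField.mpullbackWithin 𝓘(ℝ, E) I (extChartAt I p).symm V (range I))
      (VectorField.mpullbackWithin 𝓘(ℝ, E) I (extChartAt I p).symm W (range I))
      ((extChartAt I p).symm ⁻¹' univ ∩ range I) (extChartAt I p p) =
      VectorField.lieBracket ℝ (chartField I p V) (chartField I p W) (extChartAt I p p) := by
    rw [preimage_univ, univ_inter]
    refine (VectorField.lieBracketWithin_of_mem_nhds
      (range_mem_nhds_extChartAt I (mem_extChartAt_target p))).trans ?_
    exact (e V).lieBracket_vectorField_eq (e W)
  have h2 : (mfderiv I 𝓘(ℝ, E) (extChartAt I p) p).inverse =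
      ContinuousLinearMap.id ℝ E := by
    rw [h1]; exact ContinuousLinearMap.inverse_id
  change (mfderiv I 𝓘(ℝ, E) (extChartAt I p) p).inverse _ = _
  rw [h2]
  refine key.trans ?_
  rw [VectorField.lieBracket, chartField_self, chartField_self]

end Chart

theorem hasFDerivAt_fderiv_inr {E F : Type*} [NormedAddCommGroup E] [NormedSpace ℝ E]
    [NormedAddCommGroup F] [NormedSpace ℝ F] {m : E × E → F} {a b : E}
    (hm : ContDiffAt ℝ 2 m (a, b)) (Z : E) :
    HasFDerivAt (fun x => fderiv ℝ m (x, b) (0, Z))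
      (((ContinuousLinearMap.apply ℝ F ((0, Z) : E × E)).comp
        (fderiv ℝ (fderiv ℝ m) (a, b))).comp (ContinuousLinearMap.inl ℝ E E)) a := by
  have h1 : DifferentiableAt ℝ (fderiv ℝ m) (a, b) :=
    (hm.fderiv_right (m := 1) (by norm_num)).differentiableAt (by norm_num)
  have h2 : HasFDerivAt (fun x : E => (x, b)) (ContinuousLinearMap.inl ℝ E E) a := by
    exact hasFDerivAt_prodMk_left a b
  have h3 := (h1.hasFDerivAt (x := (a, b))).comp a h2
  exact (ContinuousLinearMap.apply ℝ F ((0, Z) : E × E)).hasFDerivAt.comp a h3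

section Group

variable {E : Type*} [NormedAddCommGroup E] [NormedSpace ℝ E]
  {H : Type*} [TopologicalSpace H] (I : ModelWithCorners ℝ E H)
  (G : Type*) [TopologicalSpace G] [ChartedSpace H G] [Group G]

/-- The multiplication of a Lie group, read in the preferred chart at the identity. -/
noncomputable def chartMul (p : E × E) : E :=
  extChartAt I (1 : G) ((extChartAt I (1 : G)).symm p.1 * (extChartAt I (1 : G)).symm p.2)

/-- The image of the identity of a Lie group in the preferred chart. -/
noncomputable def chartOne : E := extChartAt I (1 : G) 1

@[simp] theorem extChartAt_symm_chartOne : (extChartAt I (1 : G)).symm (chartOne I G) = 1 :=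
  extChartAt_to_inv 1

theorem chartOne_mem_target : chartOne I G ∈ (extChartAt I (1 : G)).target :=
  mem_extChartAt_target 1

theorem one_mem_chart_source : (1 : G) ∈ (extChartAt I (1 : G)).source :=
  mem_extChartAt_source 1

theorem chartMul_one_left {y : E} (hy : y ∈ (extChartAt I (1 : G)).target) :
    chartMul I G (chartOne I G, y) = y := by
  rw [chartMul, extChartAt_symm_chartOne, one_mul, PartialEquiv.right_inv _ hy]

theorem chartMul_one_right {y : E} (hy : y ∈ (extChartAt I (1 : G)).target) :
    chartMul I G (y, chartOne I G) = y := by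
  rw [chartMul, extChartAt_symm_chartOne, mul_one, PartialEquiv.right_inv _ hy]

variable [LieGroup I ∞ G] [BoundarylessManifold I G]

theorem chart_target_mem_nhds : (extChartAt I (1 : G)).target ∈ 𝓝 (chartOne I G) :=
  extChartAt_target_mem_nhds_of_mem I (chartOne_mem_target I G)

theorem contDiffAt_chartMul : ContDiffAt ℝ ∞ (chartMul I G) (chartOne I G, chartOne I G) := by
  refine contDiffAt_extChartAt_comp I (ContMDiffAt.mul (I := I) ?_ ?_) ?_
  · exact contMDiffAt_extChartAt_symm_comp I contDiffAt_fst (chartOne_mem_target I G)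
  · exact contMDiffAt_extChartAt_symm_comp I contDiffAt_snd (chartOne_mem_target I G)
  · rw [extChartAt_symm_chartOne, mul_one]
    exact one_mem_chart_source I G

theorem contDiffAt_two_chartMul :
    ContDiffAt ℝ 2 (chartMul I G) (chartOne I G, chartOne I G) :=
  (contDiffAt_chartMul I G).of_le (by norm_cast)

theorem fderiv_chartMul_inr (Z : E) :
    fderiv ℝ (chartMul I G) (chartOne I G, chartOne I G) (0, Z) = Z := by
  have h := ((contDiffAt_two_chartMul I G).differentiableAt (by norm_num)).hasFDerivAt.comp
    (chartOne I G) (hasFDerivAt_prodMk_right (𝕜 := ℝ) (chartOne I G) (chartOne I G))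
  have h2 : (chartMul I G ∘ fun y => (chartOne I G, y)) =ᶠ[𝓝 (chartOne I G)] id := by
    filter_upwards [chart_target_mem_nhds I G] with y hy using chartMul_one_left I G hy
  have h3 := h.unique ((hasFDerivAt_id _).congr_of_eventuallyEq h2)
  simpa using congrArg (fun L : E →L[ℝ] E => L Z) h3

theorem fderiv_chartMul_inl (Z : E) :
    fderiv ℝ (chartMul I G) (chartOne I G, chartOne I G) (Z, 0) = Z := by
  have h := ((contDiffAt_two_chartMul I G).differentiableAt (by norm_num)).hasFDerivAt.comp
    (chartOne I G) (f := fun y => (y, chartOne I G))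
    (hasFDerivAt_prodMk_left (𝕜 := ℝ) (chartOne I G) (chartOne I G))
  have h2 : (chartMul I G ∘ fun y => (y, chartOne I G)) =ᶠ[𝓝 (chartOne I G)] id := by
    filter_upwards [chart_target_mem_nhds I G] with y hy using chartMul_one_right I G hy
  have h3 := h.unique ((hasFDerivAt_id _).congr_of_eventuallyEq h2)
  simpa using congrArg (fun L : E →L[ℝ] E => L Z) h3

theorem eventually_differentiableAt_chartMul :
    ∀ᶠ p in 𝓝 (chartOne I G, chartOne I G), DifferentiableAt ℝ (chartMul I G) p := by
  filter_upwards [(contDiffAt_two_chartMul I G).eventually (by norm_num)] with p hp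
  exact hp.differentiableAt (by norm_num)

theorem chartField_mulInvariantVectorField (Z : GroupLieAlgebra I G) :
    ∀ᶠ x in 𝓝 (chartOne I G), chartField I (1 : G) (mulInvariantVectorField Z) x =
      fderiv ℝ (chartMul I G) (x, chartOne I G) (0, Z) := by
  have hc : Tendsto (fun x : E => (x, chartOne I G)) (𝓝 (chartOne I G))
      (𝓝 (chartOne I G, chartOne I G)) := by
    exact (Continuous.prodMk_left (chartOne I G)).tendsto _
  filter_upwards [chart_target_mem_nhds I G,
    hc.eventually (eventually_differentiableAt_chartMul I G)] with x hx hd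
  have : IsManifold I 1 G := IsManifold.of_le (n := ∞) (by simp)
  set g := (extChartAt I (1 : G)).symm x with hg
  have hgs : g ∈ (extChartAt I (1 : G)).source := (extChartAt I (1 : G)).map_target hx
  have hmul : MDifferentiableAt I I (fun b => g * b) (1 : G) :=
    (contMDiff_mul_left (I := I) (n := ∞)).mdifferentiableAt (by simp)
  have hgs' : g * 1 ∈ (chartAt H (1 : G)).source := by simpa using hgs
  have hch : MDifferentiableAt I 𝓘(ℝ, E) (extChartAt I (1 : G)) (g * 1) :=
    mdifferentiableAt_extChartAt hgs'
  have h1 := mfderiv_comp (1 : G) hch hmul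
  rw [mfderiv_eq_fderiv_chart I (hch.comp (1 : G) hmul)] at h1
  have h2 : ∀ h, h = g → (mfderiv I 𝓘(ℝ, E) (extChartAt I (1 : G)) h : E →L[ℝ] E) =
      mfderiv I 𝓘(ℝ, E) (extChartAt I (1 : G)) g := by rintro _ rfl; rfl
  have h3 : chartField I (1 : G) (mulInvariantVectorField Z) x =
      fderiv ℝ ((extChartAt I (1 : G) ∘ fun b => g * b) ∘ (extChartAt I (1 : G)).symm)
        (chartOne I G) Z := by
    refine Eq.trans ?_ (congrArg (fun L : E →L[ℝ] E => L Z) h1).symm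
    change (mfderiv I 𝓘(ℝ, E) (extChartAt I (1 : G)) g : E →L[ℝ] E) _ =
      (mfderiv I 𝓘(ℝ, E) (extChartAt I (1 : G)) (g * 1) : E →L[ℝ] E) _
    rw [h2 _ (mul_one g)]
    rfl
  rw [h3]
  have h4 := hd.hasFDerivAt.comp
    (chartOne I G) (hasFDerivAt_prodMk_right (𝕜 := ℝ) x (chartOne I G))
  have h5 : HasFDerivAt ((extChartAt I (1 : G) ∘ fun b => g * b) ∘ (extChartAt I (1 : G)).symm) _
    (chartOne I G) := h4
  rw [h5.fderiv]
  rfl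

/-- The mixed second derivative of the multiplication in the preferred chart at the identity. -/
noncomputable def mixedDeriv (Y Z : E) : E :=
  fderiv ℝ (fderiv ℝ (chartMul I G)) (chartOne I G, chartOne I G) (Y, 0) (0, Z)

theorem fderiv_chartField_mulInvariantVectorField (Z : GroupLieAlgebra I G) (Y : E) :
    fderiv ℝ (chartField I (1 : G) (mulInvariantVectorField Z)) (chartOne I G) Y =
      mixedDeriv I G Y Z := by
  have h : HasFDerivAt _ _ _ := (hasFDerivAt_fderiv_inr (contDiffAt_two_chartMul I G)
    Z).congr_of_eventuallyEq (chartField_mulInvariantVectorField I G Z)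
  rw [h.fderiv]
  simp [mixedDeriv]

theorem mulInvariantVectorField_one (Z : GroupLieAlgebra I G) :
    mulInvariantVectorField Z (1 : G) = Z := by
  exact (chartField_self I (1 : G) (mulInvariantVectorField Z)).symm.trans
    ((chartField_mulInvariantVectorField I G Z).self_of_nhds.trans (fderiv_chartMul_inr I G Z))

theorem bracket_eq_mixedDeriv (Y Z : GroupLieAlgebra I G) :
    ⁅Y, Z⁆ = (mixedDeriv I G Y Z - mixedDeriv I G Z Y : E) := by
  rw [GroupLieAlgebra.bracket_def, mlieBracket_eq_chartField]
  erw [fderiv_chartField_mulInvariantVectorField, fderiv_chartField_mulInvariantVectorField,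
    mulInvariantVectorField_one, mulInvariantVectorField_one]

end Group

section Adjoint

variable {E : Type*} [NormedAddCommGroup E] [NormedSpace ℝ E]
  {H : Type*} [TopologicalSpace H] (I : ModelWithCorners ℝ E H)
  {G : Type*} [TopologicalSpace G] [ChartedSpace H G] [Group G]

/-- The conjugation by an element of a Lie group, read in the preferred chart at the identity. -/
noncomputable def chartConj (g : G) (y : E) : E :=
  extChartAt I (1 : G) (g * (extChartAt I (1 : G)).symm y * g⁻¹)

/-- The adjoint action of a Lie group, in the preferred chart at the identity. -/
noncomputable def adjointAction (g : G) : E →L[ℝ] E :=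
  fderiv ℝ (chartConj I g) (chartOne I G)

@[simp] theorem chartConj_chartOne (g : G) : chartConj I g (chartOne I G) = chartOne I G := by
  rw [chartConj, extChartAt_symm_chartOne, mul_one, mul_inv_cancel]
  rfl

theorem conj_symm_mem_nhds : (extChartAt I (1 : G)).source ∈
    𝓝 ((extChartAt I (1 : G)).symm (chartOne I G) * (extChartAt I (1 : G)).symm (chartOne I G) *
        ((extChartAt I (1 : G)).symm (chartOne I G))⁻¹) := by
  rw [extChartAt_symm_chartOne, mul_one, mul_inv_cancel]
  exact extChartAt_source_mem_nhds 1

theorem tendsto_prodMk_chartOne : Tendsto (fun x : E => (x, chartOne I G)) (𝓝 (chartOne I G))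
    (𝓝 (chartOne I G, chartOne I G)) :=
  (Continuous.prodMk_left (chartOne I G)).tendsto _

variable [LieGroup I ∞ G] [BoundarylessManifold I G]

theorem differentiableAt_chartConj (g : G) :
    DifferentiableAt ℝ (chartConj I g) (chartOne I G) := by
  refine ContDiffAt.differentiableAt (n := ∞) (contDiffAt_extChartAt_comp I ?_ ?_) (by simp)
  · refine ContMDiffAt.mul (I := I) (ContMDiffAt.mul (I := I) contMDiffAt_const ?_)
      contMDiffAt_const
    exact contMDiffAt_extChartAt_symm_comp I contDiffAt_id (chartOne_mem_target I G)
  · rw [extChartAt_symm_chartOne, mul_one, mul_inv_cancel]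
    exact one_mem_chart_source I G

theorem hasFDerivAt_chartConj (g : G) :
    HasFDerivAt (chartConj I g) (adjointAction I g) (chartOne I G) :=
  (differentiableAt_chartConj I g).hasFDerivAt

theorem eventually_chartConj_symm (g : G) : ∀ᶠ y in 𝓝 (chartOne I G),
    (extChartAt I (1 : G)).symm (chartConj I g y) =
      g * (extChartAt I (1 : G)).symm y * g⁻¹ := by
  have hs : ContinuousAt (fun y : E => g * (extChartAt I (1 : G)).symm y * g⁻¹)
      (chartOne I G) := by
    have h : ContMDiffAt 𝓘(ℝ, E) I ∞ (fun y : E => g * (extChartAt I (1 : G)).symm y * g⁻¹)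
        (chartOne I G) :=
      ContMDiffAt.mul (I := I) (ContMDiffAt.mul (I := I) contMDiffAt_const
        (contMDiffAt_extChartAt_symm_comp I contDiffAt_id (chartOne_mem_target I G)))
        contMDiffAt_const
    exact h.continuousAt
  have hm : (extChartAt I (1 : G)).source ∈
      𝓝 (g * (extChartAt I (1 : G)).symm (chartOne I G) * g⁻¹) := by
    rw [extChartAt_symm_chartOne, mul_one, mul_inv_cancel]
    exact extChartAt_source_mem_nhds 1
  filter_upwards [hs.eventually_mem hm] with y hy
  exact (extChartAt I (1 : G)).left_inv hy

theorem adjointAction_mul (g h : G) :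
    adjointAction I (g * h) = (adjointAction I g).comp (adjointAction I h) := by
  have h1 : HasFDerivAt (chartConj I g ∘ chartConj I h)
      ((adjointAction I g).comp (adjointAction I h)) (chartOne I G) := by
    refine HasFDerivAt.comp _ ?_ (hasFDerivAt_chartConj I h)
    rw [chartConj_chartOne]
    exact hasFDerivAt_chartConj I g
  refine (hasFDerivAt_chartConj I (g * h)).unique (h1.congr_of_eventuallyEq ?_)
  filter_upwards [eventually_chartConj_symm I h] with y hy
  rw [Function.comp_apply, chartConj, chartConj, hy]
  congr 1
  group

/-- The map `(x, y) ↦ x * y * x⁻¹` of a Lie group, read in the preferred chart at the identity. -/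
noncomputable def chartConjPair (G : Type*) [TopologicalSpace G] [ChartedSpace H G] [Group G]
    (p : E × E) : E :=
  chartConj I ((extChartAt I (1 : G)).symm p.1) p.2

theorem contMDiffAt_conj_symm :
    ContMDiffAt 𝓘(ℝ, E × E) I ∞ (fun p : E × E =>
      (extChartAt I (1 : G)).symm p.1 * (extChartAt I (1 : G)).symm p.2 *
        ((extChartAt I (1 : G)).symm p.1)⁻¹) (chartOne I G, chartOne I G) := by
  have h1 : ContMDiffAt 𝓘(ℝ, E × E) I ∞ (fun p : E × E => (extChartAt I (1 : G)).symm p.1)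
      (chartOne I G, chartOne I G) :=
    contMDiffAt_extChartAt_symm_comp I contDiffAt_fst (chartOne_mem_target I G)
  have h2 : ContMDiffAt 𝓘(ℝ, E × E) I ∞ (fun p : E × E => (extChartAt I (1 : G)).symm p.2)
      (chartOne I G, chartOne I G) :=
    contMDiffAt_extChartAt_symm_comp I contDiffAt_snd (chartOne_mem_target I G)
  exact ContMDiffAt.mul (I := I) (ContMDiffAt.mul (I := I) h1 h2) (ContMDiffAt.inv (I := I) h1)

theorem contDiffAt_chartConjPair :
    ContDiffAt ℝ 2 (chartConjPair I G) (chartOne I G, chartOne I G) := by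
  refine ContDiffAt.of_le (n := ∞) ?_ (by norm_cast)
  exact contDiffAt_extChartAt_comp I (contMDiffAt_conj_symm I)
    (mem_of_mem_nhds (conj_symm_mem_nhds I))

theorem chartMul_chartConjPair : ∀ᶠ p in 𝓝 (chartOne I G, chartOne I G),
    chartMul I G (chartConjPair I G p, p.1) = chartMul I G p := by
  filter_upwards [(contMDiffAt_conj_symm I).continuousAt.eventually_mem
    (conj_symm_mem_nhds I)] with p hp
  rw [chartMul, chartConjPair, chartConj, PartialEquiv.left_inv _ hp, inv_mul_cancel_right]
  rfl

theorem adjointAction_symm_eq (Z : E) : ∀ᶠ x in 𝓝 (chartOne I G),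
    adjointAction I ((extChartAt I (1 : G)).symm x) Z =
      fderiv ℝ (chartConjPair I G) (x, chartOne I G) (0, Z) := by
  have hd : ∀ᶠ p in 𝓝 (chartOne I G, chartOne I G), DifferentiableAt ℝ (chartConjPair I G) p := by
    filter_upwards [(contDiffAt_chartConjPair (G := G) I).eventually (by norm_num)] with p hp
    exact hp.differentiableAt (by norm_num)
  filter_upwards [(tendsto_prodMk_chartOne I (G := G)).eventually hd] with x hx
  have h4 := hx.hasFDerivAt.comp
    (chartOne I G) (hasFDerivAt_prodMk_right (𝕜 := ℝ) x (chartOne I G))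
  have h5 := (hasFDerivAt_chartConj I ((extChartAt I (1 : G)).symm x)).unique h4
  rw [h5]
  rfl

theorem fderiv_chartMul_adjointAction (Z : E) : ∀ᶠ x in 𝓝 (chartOne I G),
    fderiv ℝ (chartMul I G) (chartOne I G, x)
      (adjointAction I ((extChartAt I (1 : G)).symm x) Z, 0) =
      fderiv ℝ (chartMul I G) (x, chartOne I G) (0, Z) := by
  have hc : Tendsto (fun x : E => (chartOne I G, x)) (𝓝 (chartOne I G))
      (𝓝 (chartOne I G, chartOne I G)) := (Continuous.prodMk_right (chartOne I G)).tendsto _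
  filter_upwards [(tendsto_prodMk_chartOne I (G := G)).eventually
      (chartMul_chartConjPair I).eventually_nhds,
    (tendsto_prodMk_chartOne I (G := G)).eventually (eventually_differentiableAt_chartMul I G),
    hc.eventually (eventually_differentiableAt_chartMul I G)] with x h1 h2 h3
  have h4 := h2.hasFDerivAt.comp
    (chartOne I G) (hasFDerivAt_prodMk_right (𝕜 := ℝ) x (chartOne I G))
  have h5 : HasFDerivAt (fun y => (chartConj I ((extChartAt I (1 : G)).symm x) y, x))
      ((ContinuousLinearMap.inl ℝ E E).comp (adjointAction I ((extChartAt I (1 : G)).symm x)))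
      (chartOne I G) :=
    (hasFDerivAt_prodMk_left _ x).comp _ (hasFDerivAt_chartConj I _)
  have h6 : HasFDerivAt (chartMul I G) (fderiv ℝ (chartMul I G) (chartOne I G, x))
      (chartConj I ((extChartAt I (1 : G)).symm x) (chartOne I G), x) := by
    rw [chartConj_chartOne]; exact h3.hasFDerivAt
  have h7 := h6.comp (chartOne I G) h5
  have h8 := h7.unique (h4.congr_of_eventuallyEq
    (((Continuous.prodMk_right x).tendsto (chartOne I G)).eventually h1))
  exact congrArg (fun L : E →L[ℝ] E => L Z) h8

@[simp] theorem adjointAction_one : adjointAction I (1 : G) = ContinuousLinearMap.id ℝ E := by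
  refine (hasFDerivAt_chartConj I (1 : G)).unique ((hasFDerivAt_id _).congr_of_eventuallyEq ?_)
  filter_upwards [chart_target_mem_nhds I G] with y hy
  rw [chartConj, one_mul, inv_one, mul_one, PartialEquiv.right_inv _ hy]
  rfl

/-- The derivative of the adjoint action of a Lie group at the identity is the Lie bracket. -/
theorem hasFDerivAt_adjointAction (Z : E) : ∃ L : E →L[ℝ] E,
    HasFDerivAt (fun x => adjointAction I ((extChartAt I (1 : G)).symm x) Z) L (chartOne I G) ∧
      ∀ Y, L Y = mixedDeriv I G Y Z - mixedDeriv I G Z Y := by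
  have h1 : HasFDerivAt _ _ _ := (hasFDerivAt_fderiv_inr (contDiffAt_chartConjPair (G := G) I)
    Z).congr_of_eventuallyEq (adjointAction_symm_eq I Z)
  refine ⟨_, h1, fun Y => ?_⟩
  set L := ((ContinuousLinearMap.apply ℝ E ((0, Z) : E × E)).comp
    (fderiv ℝ (fderiv ℝ (chartConjPair I G)) (chartOne I G, chartOne I G))).comp
      (ContinuousLinearMap.inl ℝ E E)
  have h2 : HasFDerivAt (fun x => fderiv ℝ (chartMul I G) (chartOne I G, x)) _ (chartOne I G) :=
    (((contDiffAt_two_chartMul I G).fderiv_right (m := 1)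
      (by norm_num)).differentiableAt (by norm_num)).hasFDerivAt.comp (chartOne I G)
      (hasFDerivAt_prodMk_right (𝕜 := ℝ) (chartOne I G) (chartOne I G))
  have h3 : HasFDerivAt (fun x => ((adjointAction I ((extChartAt I (1 : G)).symm x) Z, 0) : E × E))
      _ (chartOne I G) := (hasFDerivAt_prodMk_left (𝕜 := ℝ) _ (0 : E)).comp _ h1
  have h4 := h2.clm_apply h3
  have h5 := (hasFDerivAt_fderiv_inr (contDiffAt_two_chartMul I G) Z).congr_of_eventuallyEq
    (fderiv_chartMul_adjointAction I Z)
  have h6 := congrArg (fun L : E →L[ℝ] E => L Y) (h4.unique h5)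
  have h7 : fderiv ℝ (chartMul I G) (chartOne I G, chartOne I G) (L Y, 0) +
      fderiv ℝ (fderiv ℝ (chartMul I G)) (chartOne I G, chartOne I G) (0, Y)
        (adjointAction I ((extChartAt I (1 : G)).symm (chartOne I G)) Z, 0) =
      mixedDeriv I G Y Z := h6
  have hsymm : IsSymmSndFDerivAt ℝ (chartMul I G) (chartOne I G, chartOne I G) :=
    (contDiffAt_two_chartMul I G).isSymmSndFDerivAt (by simp)
  rw [fderiv_chartMul_inl, extChartAt_symm_chartOne, adjointAction_one, hsymm.eq] at h7
  exact eq_sub_of_add_eq h7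

theorem continuous_adjointAction_apply (Z : E) : Continuous (fun g : G => adjointAction I g Z) := by
  have : IsTopologicalGroup G := topologicalGroup_of_lieGroup I ∞
  have h1 : ContinuousAt (fun g : G => adjointAction I g Z) 1 := by
    obtain ⟨L, hL, -⟩ := hasFDerivAt_adjointAction (G := G) I Z
    have h : ContinuousAt (extChartAt I (1 : G)) 1 := continuousAt_extChartAt 1
    have h2 : ContinuousAt (fun g : G => adjointAction I ((extChartAt I (1 : G)).symm
      (extChartAt I (1 : G) g)) Z) 1 := hL.continuousAt.comp (f := extChartAt I (1 : G)) h
    refine h2.congr ?_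
    filter_upwards [extChartAt_source_mem_nhds (I := I) (1 : G)] with g hg
    rw [PartialEquiv.left_inv _ hg]
  rw [continuous_iff_continuousAt]
  intro g
  have h2 : (fun h : G => adjointAction I h Z) =
      fun h => adjointAction I g (adjointAction I (g⁻¹ * h) Z) := by
    ext h
    rw [← ContinuousLinearMap.comp_apply, ← adjointAction_mul, mul_inv_cancel_left]
  rw [h2]
  refine (adjointAction I g).continuous.continuousAt.comp ?_
  refine ContinuousAt.comp (f := fun h => g⁻¹ * h) (g := fun h => adjointAction I h Z) ?_
    (continuous_const_mul g⁻¹).continuousAt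
  simpa using h1

end Adjoint

section SkewEndomorphisms

variable {V : Type*} [AddCommGroup V] [Module ℝ V]

/-- The inner product given by a positive definite symmetric bilinear form. -/
@[reducible] noncomputable def innerCoreOfPosDef (B : LinearMap.BilinForm ℝ V)
    (hs : ∀ u v, B u v = B v u) (hp : ∀ v, v ≠ 0 → 0 < B v v) : InnerProductSpace.Core ℝ V where
  inner u v := B u v
  conj_inner_symm u v := by simp [hs u v]
  re_inner_nonneg v := by
    by_cases hv : v = 0
    · simp [hv]
    · simpa using (hp v hv).le
  add_left u v w := by simp
  smul_left u v r := by simp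
  definite v hv := by
    by_contra h
    exact (hp v h).ne' hv

theorem isComplexEigenvalue_of_sq {D : V →ₗ[ℝ] V} {v : V} {l : ℝ} (hl : l ≠ 0) (hv : v ≠ 0)
    (h : D (D v) = -(l ^ 2) • v) : IsComplexEigenvalue D (l * Complex.I) := by
  have hne : (1 : ℂ) ⊗ₜ[ℝ] D v + (l * Complex.I) ⊗ₜ[ℝ] v ≠ 0 := by
    intro h0
    have h1 : (Complex.imLm.rTensor V ((1 : ℂ) ⊗ₜ[ℝ] D v + (l * Complex.I) ⊗ₜ[ℝ] v)) = 0 := by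
      rw [h0, map_zero]
    have h2 := congrArg (TensorProduct.lid ℝ V) h1
    simp [hl, hv] at h2
  refine Module.End.hasEigenvalue_of_hasEigenvector (x := (1 : ℂ) ⊗ₜ[ℝ] D v +
    (l * Complex.I) ⊗ₜ[ℝ] v) ⟨Module.End.mem_eigenspace_iff.2 ?_, hne⟩
  rw [map_add, LinearMap.baseChange_tmul, LinearMap.baseChange_tmul, h, smul_add,
    TensorProduct.smul_tmul', TensorProduct.smul_tmul', smul_eq_mul, smul_eq_mul, mul_one,
    TensorProduct.tmul_smul, TensorProduct.smul_tmul', add_comm]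
  congr 2
  rw [Complex.real_smul]
  push_cast
  linear_combination ((l : ℂ) ^ 2) * Complex.I_sq.symm

variable [FiniteDimensional ℝ V] {B : LinearMap.BilinForm ℝ V}
    (hs : ∀ u v, B u v = B v u) (hp : ∀ v, v ≠ 0 → 0 < B v v)
    {S : V →ₗ[ℝ] V} (hS : ∀ u v, B (S u) v = -B u (S v))

include hs hp hS in
theorem trace_comp_self_of_skew :
    LinearMap.trace ℝ V (S ∘ₗ S) ≤ 0 ∧ (LinearMap.trace ℝ V (S ∘ₗ S) = 0 → S = 0) := by
  let c := innerCoreOfPosDef B hs hp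
  let _ : NormedAddCommGroup V := c.toNormedAddCommGroup
  let _ : InnerProductSpace ℝ V := .ofCore c.toCore
  let b := stdOrthonormalBasis ℝ V
  have h : LinearMap.trace ℝ V (S ∘ₗ S) = -∑ i, ‖S (b i)‖ ^ 2 := by
    rw [LinearMap.trace_eq_sum_inner _ b, ← Finset.sum_neg_distrib]
    refine Finset.sum_congr rfl fun i _ => ?_
    have h1 : inner ℝ (S (b i)) (S (b i)) = -inner ℝ (b i) (S (S (b i))) := hS _ _
    rw [← real_inner_self_eq_norm_sq, h1, neg_neg]
    rfl
  refine ⟨?_, fun h0 => b.toBasis.ext fun i => ?_⟩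
  · rw [h]
    exact neg_nonpos.2 (Finset.sum_nonneg fun i _ => by positivity)
  · rw [h, neg_eq_zero, Finset.sum_eq_zero_iff_of_nonneg (fun i _ => by positivity)] at h0
    simpa using h0 i (Finset.mem_univ i)

include hs hp hS in
theorem exists_decomposition_of_skew (α : ℝ)
    (hα : ∀ μ : ℂ, IsComplexEigenvalue S μ →
      μ = 0 ∨ μ = α * Complex.I ∨ μ = -(α * Complex.I)) (v : V) :
    ∃ v₀ v₁, v = v₀ + v₁ ∧ S v₀ = 0 ∧ S (S v₁) = -(α ^ 2) • v₁ ∧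
      (α = 0 → v₁ = 0) := by
  let c := innerCoreOfPosDef B hs hp
  let _ : NormedAddCommGroup V := c.toNormedAddCommGroup
  let _ : InnerProductSpace ℝ V := .ofCore c.toCore
  have hS' : ∀ u v : V, inner ℝ (S u) v = -inner ℝ u (S v) := hS
  have hsym : (S ∘ₗ S).IsSymmetric := fun u w => by
    simp only [LinearMap.comp_apply, hS', neg_neg]
  let b := hsym.eigenvectorBasis rfl
  have hb : ∀ i, S (b i) = 0 ∨ (S (S (b i)) = -(α ^ 2) • b i ∧ α ≠ 0) := by
    intro i
    have hbi : b i ≠ 0 := b.orthonormal.ne_zero i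
    have h1 : S (S (b i)) = hsym.eigenvalues rfl i • b i := by
      exact hsym.apply_eigenvectorBasis rfl i
    set μ := hsym.eigenvalues rfl i
    have h2 : ‖S (b i)‖ ^ 2 = -μ := by
      rw [← real_inner_self_eq_norm_sq, hS', h1, inner_smul_right, real_inner_self_eq_norm_sq,
        b.orthonormal.1 i]
      simp
    by_cases h0 : S (b i) = 0
    · exact Or.inl h0
    right
    have hl : ‖S (b i)‖ ≠ 0 := norm_ne_zero_iff.2 h0
    have h3 := hα _ (isComplexEigenvalue_of_sq hl hbi (by rw [h1, h2, neg_neg]))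
    have h4 : ‖S (b i)‖ = α ∨ ‖S (b i)‖ = -α := by
      rcases h3 with h | h | h
      · simp [hl] at h
      · left
        simpa using h
      · right
        rw [← neg_mul] at h
        exact_mod_cast mul_right_cancel₀ Complex.I_ne_zero h
    have h5 : ‖S (b i)‖ ^ 2 = α ^ 2 := by rcases h4 with h | h <;> simp [h]
    refine ⟨?_, fun h => hl (by simpa [h] using h4)⟩
    rw [h1, ← h5, h2, neg_neg]
  have hv : v ∈ Submodule.span ℝ (range b.toBasis) := by
    rw [b.toBasis.span_eq]; exact Submodule.mem_top
  induction hv using Submodule.span_induction with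
  | mem x hx =>
    obtain ⟨i, rfl⟩ := hx
    rw [OrthonormalBasis.coe_toBasis]
    rcases hb i with h | h
    · exact ⟨b i, 0, by simp, h, by simp, by simp⟩
    · exact ⟨0, b i, by simp, by simp, h.1, fun h0 => absurd h0 h.2⟩
  | zero => exact ⟨0, 0, by simp⟩
  | add x y _ _ hx hy =>
    obtain ⟨x₀, x₁, rfl, hx0, hx1, hx2⟩ := hx
    obtain ⟨y₀, y₁, rfl, hy0, hy1, hy2⟩ := hy
    exact ⟨x₀ + y₀, x₁ + y₁, by abel, by simp [hx0, hy0], by simp [hx1, hy1],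
      fun h => by rw [hx2 h, hy2 h, add_zero]⟩
  | smul r x _ hx =>
    obtain ⟨x₀, x₁, rfl, hx0, hx1, hx2⟩ := hx
    exact ⟨r • x₀, r • x₁, smul_add _ _ _, by simp [hx0], by
      rw [map_smul, map_smul, hx1, smul_comm], fun h => by rw [hx2 h, smul_zero]⟩

end SkewEndomorphisms

theorem killingForm_neg_of_invariant_form {L : Type*} [LieRing L] [LieAlgebra ℝ L]
    [hfd : FiniteDimensional ℝ L] [LieAlgebra.IsSemisimple ℝ L] {B : LinearMap.BilinForm ℝ L}
    (hs : ∀ u v, B u v = B v u) (hp : ∀ v, v ≠ 0 → 0 < B v v)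
    (hB : ∀ Y u v : L, B ⁅Y, u⁆ v = -B u ⁅Y, v⁆) (Y : L) (hY : Y ≠ 0) :
    killingForm ℝ L Y Y < 0 := by
  have h := trace_comp_self_of_skew hs hp (S := LieAlgebra.ad ℝ L Y) (hB Y)
  refine lt_of_le_of_ne h.1 fun h0 => hY ?_
  have h1 : Y ∈ LieAlgebra.center ℝ L := by
    rw [LieModule.mem_maxTrivSubmodule]
    intro Z
    rw [← lie_skew, neg_eq_zero]
    exact congrArg (fun S : L →ₗ[ℝ] L => S Z) (h.2 h0)
  rw [LieAlgebra.center_eq_bot] at h1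
  simpa using h1

section InvariantForm

variable {E : Type*} [NormedAddCommGroup E] [NormedSpace ℝ E] [FiniteDimensional ℝ E]
  {H : Type*} [TopologicalSpace H] (I : ModelWithCorners ℝ E H)
  (G : Type*) [TopologicalSpace G] [ChartedSpace H G] [Group G] [LieGroup I ∞ G]
  [BoundarylessManifold I G]

open MeasureTheory in
/-- A compact Lie group has an inner product on its Lie algebra that is invariant under the
adjoint action. -/
theorem exists_adjointAction_invariant_form [CompactSpace G] :
    ∃ B : LinearMap.BilinForm ℝ E, (∀ u v, B u v = B v u) ∧ (∀ v, v ≠ 0 → 0 < B v v) ∧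
      ∀ (g : G) (u v : E), B (adjointAction I g u) (adjointAction I g v) = B u v := by
  have : IsTopologicalGroup G := topologicalGroup_of_lieGroup I ∞
  let _ : MeasurableSpace G := borel G
  have : BorelSpace G := ⟨rfl⟩
  let μ : Measure G := Measure.haar
  let f (u v : E) (g : G) : ℝ :=
    inner ℝ (toEuclidean (adjointAction I g⁻¹ u)) (toEuclidean (adjointAction I g⁻¹ v))
  have hc (u : E) : Continuous fun g : G => toEuclidean (adjointAction I g⁻¹ u) :=
    toEuclidean.continuous.comp ((continuous_adjointAction_apply I u).comp continuous_inv)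
  have hf (u v : E) : Continuous (f u v) := (hc u).inner (hc v)
  have hint (u v : E) : Integrable (f u v) μ :=
    (hf u v).integrable_of_hasCompactSupport (HasCompactSupport.of_compactSpace _)
  let B : LinearMap.BilinForm ℝ E := LinearMap.mk₂ ℝ (fun u v => ∫ g, f u v g ∂μ)
    (fun u u' v => by
      rw [← integral_add (hint u v) (hint u' v)]
      simp only [f, map_add, inner_add_left])
    (fun c u v => by
      rw [smul_eq_mul, ← integral_const_mul]
      simp only [f, map_smul, real_inner_smul_left])
    (fun u v v' => by
      rw [← integral_add (hint u v) (hint u v')]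
      simp only [f, map_add, inner_add_right])
    (fun c u v => by
      rw [smul_eq_mul, ← integral_const_mul]
      simp only [f, map_smul, real_inner_smul_right])
  refine ⟨B, fun u v => ?_, fun v hv => ?_, fun g u v => ?_⟩
  · change ∫ g, f u v g ∂μ = ∫ g, f v u g ∂μ
    simp only [f, real_inner_comm]
  · change 0 < ∫ g, f v v g ∂μ
    refine (hf v v).integral_pos_of_hasCompactSupport_nonneg_nonzero
      (HasCompactSupport.of_compactSpace _) (fun g => real_inner_self_nonneg) (x := 1) ?_
    simp [f, hv]
  · change ∫ h, f (adjointAction I g u) (adjointAction I g v) h ∂μ = ∫ h, f u v h ∂μ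
    rw [← integral_mul_left_eq_self (f u v) g⁻¹]
    refine integral_congr_ae (Eventually.of_forall fun h => ?_)
    simp only [f, ← ContinuousLinearMap.comp_apply, ← adjointAction_mul, mul_inv_rev, inv_inv]

theorem ad_skew_of_invariant {B : LinearMap.BilinForm ℝ E}
    (hB : ∀ (g : G) (u v : E), B (adjointAction I g u) (adjointAction I g v) = B u v)
    (Y u v : E) : B (mixedDeriv I G Y u - mixedDeriv I G u Y) v =
      -B u (mixedDeriv I G Y v - mixedDeriv I G v Y) := by
  obtain ⟨Lu, hu, hu'⟩ := hasFDerivAt_adjointAction (G := G) I u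
  obtain ⟨Lv, hv, hv'⟩ := hasFDerivAt_adjointAction (G := G) I v
  have h1 := B.toContinuousBilinearMap.hasFDerivAt_of_bilinear hu hv
  have h2 : HasFDerivAt (fun x : E => B.toContinuousBilinearMap
      (adjointAction I ((extChartAt I (1 : G)).symm x) u)
      (adjointAction I ((extChartAt I (1 : G)).symm x) v)) (0 : E →L[ℝ] ℝ) (chartOne I G) := by
    simp only [LinearMap.toContinuousBilinearMap_apply, hB]
    exact hasFDerivAt_const _ _
  have h3 := congrArg (fun L : E →L[ℝ] ℝ => L Y) (h1.unique h2)
  have h4 : B u (Lv Y) + B (Lu Y) v = 0 := by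
    have h5 : B (adjointAction I ((extChartAt I (1 : G)).symm (chartOne I G)) u) (Lv Y) +
      B (Lu Y) (adjointAction I ((extChartAt I (1 : G)).symm (chartOne I G)) v) = 0 := h3
    simpa only [extChartAt_symm_chartOne, adjointAction_one, ContinuousLinearMap.id_apply] using h5
  rw [hu', hv'] at h4
  linear_combination h4

theorem killingForm_neg [CompactSpace G]
    (hG : IsSemisimpleLieGroup I G) (Y : GroupLieAlgebra I G) (hY : Y ≠ 0) :
    killingForm ℝ (GroupLieAlgebra I G) Y Y < 0 := by
  obtain ⟨B, hs, hp, hB⟩ := exists_adjointAction_invariant_form I G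
  have hss : LieAlgebra.IsSemisimple ℝ (GroupLieAlgebra I G) := hG
  refine killingForm_neg_of_invariant_form (hfd := inferInstanceAs (FiniteDimensional ℝ E))
    (B := B) hs hp (fun Y u v => ?_) Y hY
  have h1 := bracket_eq_mixedDeriv I G Y u
  have h2 := bracket_eq_mixedDeriv I G Y v
  rw [h1, h2]
  exact ad_skew_of_invariant I G hB Y u v

end InvariantForm

section FlowDerivative

variable {E : Type*} [NormedAddCommGroup E] [NormedSpace ℝ E]
  {H : Type*} [TopologicalSpace H] (I : ModelWithCorners ℝ E H)
  {M : Type*} [TopologicalSpace M] [ChartedSpace H M]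

theorem forall_mem_chart_ball_of_integralCurve [T2Space M] [FiniteDimensional ℝ E]
    {p : M} {γ : ℝ → M} (hγ : Continuous γ) {δ T : ℝ}
    (hδ : Metric.closedBall (extChartAt I p p) δ ⊆ (extChartAt I p).target)
    (h0 : γ 0 ∈ (extChartAt I p).symm '' Metric.ball (extChartAt I p p) δ)
    (hstep : ∀ τ ∈ Icc 0 T,
      (∀ t ∈ Icc 0 τ, γ t ∈ (extChartAt I p).symm '' Metric.closedBall (extChartAt I p p) δ) →
      extChartAt I p (γ τ) ∈ Metric.ball (extChartAt I p p) δ) :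
    ∀ t ∈ Icc 0 T, γ t ∈ (extChartAt I p).symm '' Metric.closedBall (extChartAt I p p) δ := by
  set e := extChartAt I p
  set W := e.symm '' Metric.closedBall (e p) δ
  set O := e.source ∩ e ⁻¹' Metric.ball (e p) δ
  have hWs : W ⊆ e.source := by
    rintro _ ⟨y, hy, rfl⟩
    exact e.map_target (hδ hy)
  have hOW : O ⊆ W := fun x hx => ⟨e x, Metric.ball_subset_closedBall hx.2, e.left_inv hx.1⟩
  have hO : IsOpen O := (continuousOn_extChartAt p).isOpen_inter_preimage
    (isOpen_extChartAt_source p) Metric.isOpen_ball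
  have : ProperSpace E := FiniteDimensional.proper_real E
  have hW : IsClosed W := ((isCompact_closedBall _ _).image_of_continuousOn
    ((continuousOn_extChartAt_symm p).mono hδ)).isClosed
  have h0' : γ 0 ∈ O := by
    obtain ⟨y, hy, h⟩ := h0
    have hyt := hδ (Metric.ball_subset_closedBall hy)
    rw [← h]
    refine ⟨e.map_target hyt, ?_⟩
    rw [mem_preimage, e.right_inv hyt]
    exact hy
  suffices h : ∀ t ∈ Icc 0 T, γ t ∈ O from fun t ht => hOW (h t ht)
  by_contra hcon
  push Not at hcon
  obtain ⟨t₀, ht₀, htO⟩ := hcon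
  have hcpt : IsCompact (Icc 0 T ∩ γ ⁻¹' Oᶜ) :=
    isCompact_Icc.inter_right (hO.isClosed_compl.preimage hγ)
  obtain ⟨τ, ⟨hτ, hτO⟩, hmin⟩ := hcpt.exists_isLeast ⟨t₀, ht₀, htO⟩
  have hlt : ∀ t ∈ Ico 0 τ, γ t ∈ O := by
    intro t ht
    by_contra h
    exact absurd (hmin ⟨⟨ht.1, ht.2.le.trans hτ.2⟩, h⟩) (not_le.2 ht.2)
  have hτ0 : (0 : ℝ) ≠ τ := by
    rintro rfl
    exact hτO h0'
  have hWτ : ∀ t ∈ Icc 0 τ, γ t ∈ W := by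
    have h : closure (Ico 0 τ) ⊆ γ ⁻¹' W :=
      closure_minimal (fun t ht => hOW (hlt t ht)) (hW.preimage hγ)
    rwa [closure_Ico hτ0] at h
  exact hτO ⟨hWs (hWτ τ (right_mem_Icc.2 hτ.1)), hstep τ hτ hWτ⟩

variable [IsManifold I ∞ M]

theorem IsMIntegralCurve.hasDerivAt_chart {X : (x : M) → TangentSpace I x} {γ : ℝ → M}
    (hγ : IsMIntegralCurve (I := I) γ X) (p : M) {t : ℝ} (ht : γ t ∈ (extChartAt I p).source) :
    HasDerivAt (fun s => extChartAt I p (γ s)) (chartField I p X (extChartAt I p (γ t))) t := by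
  have : IsManifold I 1 M := IsManifold.of_le (n := ∞) (by simp)
  have h1 : HasMFDerivAt I 𝓘(ℝ, E) (extChartAt I p) (γ t)
      (mfderiv I 𝓘(ℝ, E) (extChartAt I p) (γ t)) :=
    (mdifferentiableAt_extChartAt (by simpa using ht)).hasMFDerivAt
  set L : E →L[ℝ] E := mfderiv I 𝓘(ℝ, E) (extChartAt I p) (γ t)
  set v : E := X (γ t)
  have h2 : HasFDerivAt (extChartAt I p ∘ γ) (L.comp ((1 : ℝ →L[ℝ] ℝ).smulRight v)) t :=
    (h1.comp t (hγ t)).hasFDerivAt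
  have h3 : chartField I p X (extChartAt I p (γ t)) = L v := by
    rw [chartField, PartialEquiv.left_inv _ ht]
    rfl
  exact h2.hasDerivAt.congr_deriv (by rw [h3]; simp)

theorem norm_sub_exp_le_of_approx_linear [CompleteSpace E] {f f' : ℝ → E} {A : E →L[ℝ] E}
    {η K T : ℝ} (hη : 0 ≤ η) (hη1 : η ≤ 1) (hK : K = ‖A‖ + 1)
    (hf : ∀ t ∈ Icc 0 T, HasDerivAt f (f' t) t)
    (hf' : ∀ t ∈ Icc 0 T, ‖f' t - A (f t)‖ ≤ η * ‖f t‖) :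
    ∀ t ∈ Icc 0 T, ‖f t‖ ≤ ‖f 0‖ * Real.exp (K * t) ∧
      ‖f t - NormedSpace.exp (t • A) (f 0)‖ ≤
        η * (‖f 0‖ * Real.exp (K * T)) / K * (Real.exp (K * t) - 1) := by
  have hK0 : 0 < K := by rw [hK]; positivity
  have hcf : ContinuousOn f (Icc 0 T) := fun t ht => (hf t ht).continuousAt.continuousWithinAt
  have h1 : ∀ t ∈ Icc 0 T, ‖f t‖ ≤ ‖f 0‖ * Real.exp (K * t) := by
    intro t ht
    have h := norm_le_gronwallBound_of_norm_deriv_right_le (δ := ‖f 0‖) (K := K) (ε := 0) hcf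
      (fun t ht => (hf t (Ico_subset_Icc_self ht)).hasDerivWithinAt) le_rfl (fun t ht => by
        have h2 := hf' t (Ico_subset_Icc_self ht)
        have h3 := A.le_opNorm (f t)
        have h4 := norm_le_norm_add_norm_sub' (f' t) (A (f t))
        have h5 : η * ‖f t‖ ≤ 1 * ‖f t‖ := by gcongr
        rw [hK]
        linarith) t ht
    rwa [gronwallBound_ε0, sub_zero] at h
  intro t ht
  refine ⟨h1 t ht, ?_⟩
  have hexp (t : ℝ) : HasDerivAt (fun t : ℝ => NormedSpace.exp (t • A) (f 0))
      (A (NormedSpace.exp (t • A) (f 0))) t :=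
    (hasDerivAt_exp_smul_const' (𝕂 := ℝ) A t).clm_apply (hasDerivAt_const t (f 0)) |>.congr_deriv
      (by simp)
  have hd : ∀ t ∈ Icc 0 T, HasDerivAt (fun t => f t - NormedSpace.exp (t • A) (f 0))
      (f' t - A (NormedSpace.exp (t • A) (f 0))) t := fun t ht => (hf t ht).sub (hexp t)
  have h := norm_le_gronwallBound_of_norm_deriv_right_le (δ := 0) (K := K)
    (ε := η * (‖f 0‖ * Real.exp (K * T)))
    (fun t ht => (hd t ht).continuousAt.continuousWithinAt)
    (fun t ht => (hd t (Ico_subset_Icc_self ht)).hasDerivWithinAt) (by simp) (fun t ht => by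
      have ht' := Ico_subset_Icc_self ht
      have h2 := hf' t ht'
      have h3 := A.le_opNorm (f t - NormedSpace.exp (t • A) (f 0))
      have h4 : f' t - A (NormedSpace.exp (t • A) (f 0)) =
        (f' t - A (f t)) + A (f t - NormedSpace.exp (t • A) (f 0)) := by
        rw [map_sub]; abel
      have h5 : η * ‖f t‖ ≤ η * (‖f 0‖ * Real.exp (K * T)) := by
        gcongr
        refine (h1 t ht').trans ?_
        gcongr
        exact ht'.2
      have h6 := norm_nonneg (f t - NormedSpace.exp (t • A) (f 0))
      rw [h4]
      refine (norm_add_le _ _).trans ?_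
      have h7 : K * ‖f t - NormedSpace.exp (t • A) (f 0)‖ =
          ‖A‖ * ‖f t - NormedSpace.exp (t • A) (f 0)‖ + ‖f t - NormedSpace.exp (t • A) (f 0)‖ := by
        rw [hK]; ring
      linarith) t ht
  simpa only [gronwallBound_of_K_ne_0 hK0.ne', zero_mul, zero_add, sub_zero] using h

variable [BoundarylessManifold I M] [T2Space M] [FiniteDimensional ℝ E]
  {X : (x : M) → TangentSpace I x}

theorem hasFDerivAt_flow {p : M}
    (hX : MDifferentiableAt I I.tangent (fun x => (⟨x, X x⟩ : TangentBundle I M)) p)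
    {φ : ℝ → M → M} (hφ : IsFlowOf I X φ) (hp : ∀ t, φ t p = p) {T : ℝ} (hT : 0 ≤ T) :
    HasFDerivAt (fun x => extChartAt I p (φ T ((extChartAt I p).symm x)))
      (NormedSpace.exp (T • fderiv ℝ (chartField I p X) (extChartAt I p p)))
      (extChartAt I p p) := by
  have : CompleteSpace E := FiniteDimensional.complete ℝ E
  set e := extChartAt I p
  set V := chartField I p X
  set A := fderiv ℝ V (e p)
  have hV : HasFDerivAt V A (e p) := (differentiableAt_chartField I hX).hasFDerivAt
  have hV0 : V (e p) = 0 := by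
    have h1 := IsMIntegralCurve.hasDerivAt_chart I (hφ.isMIntegralCurve p) p (t := 0)
      (by rw [hp]; exact mem_extChartAt_source p)
    simp only [hp] at h1
    exact h1.unique (hasDerivAt_const _ _)
  set K := ‖A‖ + 1 with hK
  have hK0 : 0 < K := by positivity
  set C := Real.exp (K * T) / K * (Real.exp (K * T) - 1) with hC
  have hC0 : 0 ≤ C := by
    have : 1 ≤ Real.exp (K * T) := Real.one_le_exp (by positivity)
    have : 0 ≤ Real.exp (K * T) - 1 := by linarith
    positivity
  rw [hasFDerivAt_iff_isLittleO, Asymptotics.isLittleO_iff]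
  intro c hc
  set η := min 1 (c / (C + 1)) with hη
  have hη0 : 0 < η := lt_min one_pos (by positivity)
  have hηC : η * C ≤ c := by
    have h1 : η ≤ c / (C + 1) := min_le_right _ _
    have h2 : η * (C + 1) ≤ c := by rwa [le_div_iff₀ (by positivity)] at h1
    nlinarith
  have hloc : ∀ᶠ y in 𝓝 (e p), ‖V y - A (y - e p)‖ ≤ η * ‖y - e p‖ ∧ y ∈ e.target := by
    have h1 := (hasFDerivAt_iff_isLittleO.1 hV).bound hη0
    filter_upwards [h1, extChartAt_target_mem_nhds_of_mem I (mem_extChartAt_target p)] with y h2 h3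
    rw [hV0, sub_zero] at h2
    exact ⟨h2, h3⟩
  obtain ⟨δ, hδ0, hδ⟩ := Metric.nhds_basis_closedBall.eventually_iff.1 hloc
  have hδt : Metric.closedBall (e p) δ ⊆ e.target := fun y hy => (hδ hy).2
  have hr : 0 < δ * Real.exp (-(K * T)) := by positivity
  filter_upwards [Metric.ball_mem_nhds (e p) hr] with x hx
  rw [Metric.mem_ball, dist_eq_norm] at hx
  have hxδ : ‖x - e p‖ * Real.exp (K * T) < δ := by
    have h1 := mul_lt_mul_of_pos_right hx (Real.exp_pos (K * T))
    rwa [mul_assoc, ← Real.exp_add, neg_add_cancel, Real.exp_zero, mul_one] at h1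
  have hexp1 : 1 ≤ Real.exp (K * T) := Real.one_le_exp (by positivity)
  have hxδ' : x ∈ Metric.ball (e p) δ := by
    rw [Metric.mem_ball, dist_eq_norm]
    nlinarith [norm_nonneg (x - e p)]
  have hxt : x ∈ e.target := hδt (Metric.ball_subset_closedBall hxδ')
  set γ : ℝ → M := fun t => φ t (e.symm x) with hγ
  have hγc : IsMIntegralCurve (I := I) γ X := hφ.isMIntegralCurve (e.symm x)
  have hγ0 : γ 0 = e.symm x := hφ.zero_apply _
  have hf0 : e (γ 0) - e p = x - e p := by rw [hγ0, e.right_inv hxt]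
  have key : ∀ τ ∈ Icc 0 T, (∀ t ∈ Icc 0 τ, γ t ∈ e.symm '' Metric.closedBall (e p) δ) →
      ∀ t ∈ Icc 0 τ, ‖e (γ t) - e p‖ ≤ ‖x - e p‖ * Real.exp (K * t) ∧
        ‖e (γ t) - e p - NormedSpace.exp (t • A) (x - e p)‖ ≤
          η * (‖x - e p‖ * Real.exp (K * τ)) / K * (Real.exp (K * t) - 1) := by
    intro τ hτ hin
    have h := norm_sub_exp_le_of_approx_linear (f := fun t => e (γ t) - e p)
      (f' := fun t => V (e (γ t))) (A := A) (T := τ) hη0.le (min_le_left _ _) hK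
      (fun t ht => by
        obtain ⟨y, hy, hyt⟩ := hin t ht
        refine (IsMIntegralCurve.hasDerivAt_chart I hγc p ?_).sub_const _
        rw [← hyt]
        exact e.map_target (hδt hy))
      (fun t ht => by
        obtain ⟨y, hy, hyt⟩ := hin t ht
        have h1 : e (γ t) = y := by rw [← hyt, e.right_inv (hδt hy)]
        rw [h1]
        exact (hδ hy).1)
    simpa only [hf0] using h
  have hall := forall_mem_chart_ball_of_integralCurve I (p := p) (γ := γ) (T := T)
    hγc.continuous hδt ⟨x, hxδ', hγ0.symm⟩ (fun τ hτ hin => by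
      have h1 := (key τ hτ hin τ (right_mem_Icc.2 hτ.1)).1
      rw [Metric.mem_ball, dist_eq_norm]
      refine h1.trans_lt (lt_of_le_of_lt ?_ hxδ)
      have := hτ.2
      gcongr)
  have hfin := (key T (right_mem_Icc.2 hT) hall T (right_mem_Icc.2 hT)).2
  have he : e (φ T (e.symm (e p))) = e p := by rw [extChartAt_to_inv, hp]
  rw [he]
  refine hfin.trans ?_
  have h1 : η * (‖x - e p‖ * Real.exp (K * T)) / K * (Real.exp (K * T) - 1) =
      (η * C) * ‖x - e p‖ := by rw [hC]; ring
  rw [h1]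
  gcongr

end FlowDerivative

section Automorphisms

variable {E : Type*} [NormedAddCommGroup E] [NormedSpace ℝ E]
  {H : Type*} [TopologicalSpace H] (I : ModelWithCorners ℝ E H)
  {G : Type*} [TopologicalSpace G] [ChartedSpace H G] [Group G]

/-- A map of a Lie group to itself, read in the preferred chart at the identity. -/
noncomputable def chartMap (ψ : G → G) (y : E) : E :=
  extChartAt I (1 : G) (ψ ((extChartAt I (1 : G)).symm y))

theorem chartMap_chartOne {ψ : G → G} (h1 : ψ 1 = 1) :
    chartMap I ψ (chartOne I G) = chartOne I G := by
  rw [chartMap, extChartAt_symm_chartOne, h1]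
  rfl

variable [LieGroup I ∞ G] [BoundarylessManifold I G]

theorem contMDiffAt_comp_symm {ψ : G → G} (hψ : ContMDiff I I ∞ ψ) :
    ContMDiffAt 𝓘(ℝ, E) I ∞ (fun y : E => ψ ((extChartAt I (1 : G)).symm y)) (chartOne I G) :=
  hψ.contMDiffAt.comp _
    (contMDiffAt_extChartAt_symm_comp I contDiffAt_id (chartOne_mem_target I G))

theorem contDiffAt_chartMap {ψ : G → G} (hψ : ContMDiff I I ∞ ψ) (h1 : ψ 1 = 1) :
    ContDiffAt ℝ 2 (chartMap I ψ) (chartOne I G) := by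
  refine ContDiffAt.of_le (n := ∞) (contDiffAt_extChartAt_comp I (contMDiffAt_comp_symm I hψ) ?_)
    (by norm_cast)
  rw [extChartAt_symm_chartOne, h1]
  exact one_mem_chart_source I G

theorem eventually_symm_chartMap {ψ : G → G} (hψ : ContMDiff I I ∞ ψ) (h1 : ψ 1 = 1) :
    ∀ᶠ y in 𝓝 (chartOne I G), (extChartAt I (1 : G)).symm (chartMap I ψ y) =
      ψ ((extChartAt I (1 : G)).symm y) := by
  have hm : (extChartAt I (1 : G)).source ∈ 𝓝 (ψ ((extChartAt I (1 : G)).symm (chartOne I G))) := by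
    rw [extChartAt_symm_chartOne, h1]
    exact extChartAt_source_mem_nhds 1
  filter_upwards [(contMDiffAt_comp_symm I hψ).continuousAt.eventually_mem hm] with y hy
  exact (extChartAt I (1 : G)).left_inv hy

theorem eventually_symm_chartMul : ∀ᶠ p in 𝓝 (chartOne I G, chartOne I G),
    (extChartAt I (1 : G)).symm (chartMul I G p) =
      (extChartAt I (1 : G)).symm p.1 * (extChartAt I (1 : G)).symm p.2 := by
  have hc : ContMDiffAt 𝓘(ℝ, E × E) I ∞ (fun p : E × E =>
      (extChartAt I (1 : G)).symm p.1 * (extChartAt I (1 : G)).symm p.2)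
      (chartOne I G, chartOne I G) :=
    ContMDiffAt.mul (I := I)
      (contMDiffAt_extChartAt_symm_comp I contDiffAt_fst (chartOne_mem_target I G))
      (contMDiffAt_extChartAt_symm_comp I contDiffAt_snd (chartOne_mem_target I G))
  have hm : (extChartAt I (1 : G)).source ∈ 𝓝 ((extChartAt I (1 : G)).symm (chartOne I G) *
      (extChartAt I (1 : G)).symm (chartOne I G)) := by
    rw [extChartAt_symm_chartOne, mul_one]
    exact extChartAt_source_mem_nhds 1
  filter_upwards [hc.continuousAt.eventually_mem hm] with p hp
  exact (extChartAt I (1 : G)).left_inv hp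

/-- The derivative at the identity of a smooth endomorphism of a Lie group preserves the Lie
bracket. -/
theorem fderiv_chartMap_bracket {ψ : G →* G} (hψ : ContMDiff I I ∞ ψ) (Y Z : E) :
    fderiv ℝ (chartMap I ψ) (chartOne I G) (mixedDeriv I G Y Z - mixedDeriv I G Z Y) =
      mixedDeriv I G (fderiv ℝ (chartMap I ψ) (chartOne I G) Y)
        (fderiv ℝ (chartMap I ψ) (chartOne I G) Z) -
      mixedDeriv I G (fderiv ℝ (chartMap I ψ) (chartOne I G) Z)
        (fderiv ℝ (chartMap I ψ) (chartOne I G) Y) := by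
  set f := chartMap I ψ
  set o := chartOne I G
  set L := fderiv ℝ f o
  have hf0 : f o = o := chartMap_chartOne I (map_one ψ)
  have hf : ContDiffAt ℝ 2 f o := contDiffAt_chartMap I hψ (map_one ψ)
  have hfo : HasFDerivAt f L o := (hf.differentiableAt (by norm_num)).hasFDerivAt
  have hhom : ∀ᶠ p in 𝓝 (o, o), f (chartMul I G p) = chartMul I G (f p.1, f p.2) := by
    have e := eventually_symm_chartMap I hψ (map_one ψ)
    have e1 : ∀ᶠ p : E × E in 𝓝 (o, o), _ := (continuous_fst.tendsto (o, o)).eventually e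
    have e2 : ∀ᶠ p : E × E in 𝓝 (o, o), _ := (continuous_snd.tendsto (o, o)).eventually e
    filter_upwards [eventually_symm_chartMul (G := G) I, e1, e2] with p h1 h2 h3
    have h4 : f (chartMul I G p) =
      extChartAt I (1 : G) (ψ ((extChartAt I (1 : G)).symm (chartMul I G p))) := rfl
    rw [h4, h1, map_mul, ← h2, ← h3]
    rfl
  have hlin (Z : E) : ∀ᶠ x in 𝓝 o, fderiv ℝ f x (fderiv ℝ (chartMul I G) (x, o) (0, Z)) =
      fderiv ℝ (chartMul I G) (f x, o) (0, L Z) := by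
    have hd : ∀ᶠ x in 𝓝 o, DifferentiableAt ℝ f x := by
      filter_upwards [hf.eventually (by norm_num)] with x hx
      exact hx.differentiableAt (by norm_num)
    have hd' := (tendsto_prodMk_chartOne I (G := G)).eventually
      (eventually_differentiableAt_chartMul I G)
    have hfc : Tendsto f (𝓝 o) (𝓝 o) := by
      have := hf.continuousAt.tendsto
      rwa [hf0] at this
    filter_upwards [(tendsto_prodMk_chartOne I (G := G)).eventually hhom.eventually_nhds,
      hd, hd', hfc.eventually hd', chart_target_mem_nhds I G] with x h1 h2 h3 h4 h5
    have h6 : HasFDerivAt f (fderiv ℝ f x) (chartMul I G (x, o)) := by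
      rw [chartMul_one_right I G h5]; exact h2.hasFDerivAt
    have h7 := h6.comp o (h3.hasFDerivAt.comp o (hasFDerivAt_prodMk_right (𝕜 := ℝ) x o))
    have h8 : HasFDerivAt (chartMul I G) (fderiv ℝ (chartMul I G) (f x, o)) (f x, f o) := by
      rw [hf0]; exact h4.hasFDerivAt
    have h9 := h8.comp o ((hasFDerivAt_prodMk_right (𝕜 := ℝ) (f x) (f o)).comp o hfo)
    have h10 := h7.unique (h9.congr_of_eventuallyEq
      (((Continuous.prodMk_right x).tendsto o).eventually h1))
    exact congrArg (fun L : E →L[ℝ] E => L Z) h10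
  have hmix (Y Z : E) : fderiv ℝ (fderiv ℝ f) o Y Z + L (mixedDeriv I G Y Z) =
      mixedDeriv I G (L Y) (L Z) := by
    have h1 : HasFDerivAt (fderiv ℝ f) (fderiv ℝ (fderiv ℝ f) o) o :=
      ((hf.fderiv_right (m := 1) (by norm_num)).differentiableAt (by norm_num)).hasFDerivAt
    have h2 := h1.clm_apply (hasFDerivAt_fderiv_inr (contDiffAt_two_chartMul I G) Z)
    have h3 : HasFDerivAt (fun x => fderiv ℝ (chartMul I G) (x, o) (0, L Z))
        (((ContinuousLinearMap.apply ℝ E ((0, L Z) : E × E)).comp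
        (fderiv ℝ (fderiv ℝ (chartMul I G)) (o, o))).comp (ContinuousLinearMap.inl ℝ E E))
        (f o) := by
      rw [hf0]
      exact hasFDerivAt_fderiv_inr (contDiffAt_two_chartMul I G) (L Z)
    have h4 := (h3.comp o hfo).congr_of_eventuallyEq (hlin Z)
    have h5 := congrArg (fun L : E →L[ℝ] E => L Y) (h2.unique h4)
    have h6 : L (mixedDeriv I G Y Z) +
      fderiv ℝ (fderiv ℝ f) o Y (fderiv ℝ (chartMul I G) (o, o) (0, Z)) =
      mixedDeriv I G (L Y) (L Z) := h5
    rw [fderiv_chartMul_inr] at h6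
    rw [add_comm, h6]
  have hsymm : IsSymmSndFDerivAt ℝ f o := hf.isSymmSndFDerivAt (by simp)
  rw [map_sub, ← hmix, ← hmix, hsymm.eq Y Z]
  abel

/-- A smooth endomorphism of a connected Lie group whose derivative at the identity is the identity
is the identity. -/
theorem eq_id_of_fderiv_chartMap_eq_id [ConnectedSpace G] {ψ : G →* G} (hψ : ContMDiff I I ∞ ψ)
    (hd : fderiv ℝ (chartMap I ψ) (chartOne I G) = ContinuousLinearMap.id ℝ E) (g : G) :
    ψ g = g := by
  have : IsTopologicalGroup G := topologicalGroup_of_lieGroup I ∞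
  set o := chartOne I G
  set e := extChartAt I (1 : G)
  have heo : e.symm o = 1 := extChartAt_symm_chartOne I G
  have hcs : ContinuousAt e.symm o :=
    (contMDiffAt_extChartAt_symm_comp I contDiffAt_id (chartOne_mem_target I G)).continuousAt
  set k : E → E := fun y => e (ψ (e.symm y) * (e.symm y)⁻¹) with hk
  have hko : k o = o := by
    simp only [hk, heo, map_one, inv_one, mul_one]
    rfl
  have hψsymm (y : E) (hy : y ∈ e.target) :
      ContMDiffAt 𝓘(ℝ, E) I ∞ (fun y : E => ψ (e.symm y) * (e.symm y)⁻¹) y := by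
    have h1 := contMDiffAt_extChartAt_symm_comp I (p := (1 : G)) contDiffAt_id hy
    exact ContMDiffAt.mul (I := I) (hψ.contMDiffAt.comp y h1) (ContMDiffAt.inv (I := I) h1)
  let d : E × E → E := fun p => e (e.symm p.1 * (e.symm p.2)⁻¹)
  have hdiv : DifferentiableAt ℝ d (o, o) := by
    refine ContDiffAt.differentiableAt (n := ∞) (contDiffAt_extChartAt_comp I ?_ ?_) (by simp)
    · exact ContMDiffAt.mul (I := I)
        (contMDiffAt_extChartAt_symm_comp I contDiffAt_fst (chartOne_mem_target I G))
        (ContMDiffAt.inv (I := I)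
          (contMDiffAt_extChartAt_symm_comp I contDiffAt_snd (chartOne_mem_target I G)))
    · change e.symm o * (e.symm o)⁻¹ ∈ e.source
      rw [heo, inv_one, mul_one]
      exact one_mem_chart_source I G
  have hk0 : HasFDerivAt k (0 : E →L[ℝ] E) o := by
    have hfo : HasFDerivAt (chartMap I ψ) (ContinuousLinearMap.id ℝ E) o := by
      rw [← hd]
      exact ((contDiffAt_chartMap I hψ (map_one ψ)).differentiableAt (by norm_num)).hasFDerivAt
    have hfo' : chartMap I ψ o = o := chartMap_chartOne I (map_one ψ)
    have h1 : HasFDerivAt d (fderiv ℝ d (o, o)) (chartMap I ψ o, id o) := by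
      rw [hfo']; exact hdiv.hasFDerivAt
    have h2 := h1.comp o (f := fun x => (chartMap I ψ x, id x)) (hfo.prodMk (hasFDerivAt_id o))
    have h3 := hdiv.hasFDerivAt.comp o (f := fun x => (id x, id x))
      ((hasFDerivAt_id (𝕜 := ℝ) o).prodMk (hasFDerivAt_id o))
    have h4 := h3.unique ((hasFDerivAt_const o o).congr_of_eventuallyEq
      (Eventually.of_forall fun y => by
        change e (e.symm y * (e.symm y)⁻¹) = o
        rw [mul_inv_cancel]
        rfl))
    rw [← h4]
    refine h2.congr_of_eventuallyEq ?_
    filter_upwards [eventually_symm_chartMap I hψ (map_one ψ)] with y hy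
    change k y = e (e.symm (chartMap I ψ y) * (e.symm y)⁻¹)
    rw [hy]
  have hks : ∀ᶠ y in 𝓝 o, ψ (e.symm y) * (e.symm y)⁻¹ ∈ e.source ∧ y ∈ e.target := by
    have hm : e.source ∈ 𝓝 (ψ (e.symm o) * (e.symm o)⁻¹) := by
      rw [heo, map_one, inv_one, mul_one]
      exact extChartAt_source_mem_nhds 1
    exact ((hψsymm o (chartOne_mem_target I G)).continuousAt.eventually_mem hm).and
      (chart_target_mem_nhds I G)
  have hkx : ∀ᶠ x in 𝓝 o, HasFDerivAt k (0 : E →L[ℝ] E) x := by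
    filter_upwards [hks] with x hx
    set a := e.symm x
    have hQ : DifferentiableAt ℝ (fun z => e (a⁻¹ * e.symm z)) x := by
      refine ContDiffAt.differentiableAt (n := ∞) (contDiffAt_extChartAt_comp I ?_ ?_) (by simp)
      · exact ContMDiffAt.mul (I := I) contMDiffAt_const
          (contMDiffAt_extChartAt_symm_comp I contDiffAt_id hx.2)
      · change a⁻¹ * a ∈ _
        rw [inv_mul_cancel]
        exact one_mem_chart_source I G
    have hQx : e (a⁻¹ * e.symm x) = o := by
      change e (a⁻¹ * a) = o
      rw [inv_mul_cancel]
      rfl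
    have hP : DifferentiableAt ℝ (fun z => e (ψ a * e.symm z * a⁻¹)) o := by
      refine ContDiffAt.differentiableAt (n := ∞) (contDiffAt_extChartAt_comp I ?_ ?_) (by simp)
      · exact ContMDiffAt.mul (I := I) (ContMDiffAt.mul (I := I) contMDiffAt_const
          (contMDiffAt_extChartAt_symm_comp I contDiffAt_id (chartOne_mem_target I G)))
          contMDiffAt_const
      · rw [heo, mul_one]
        exact hx.1
    have h1 : HasFDerivAt k (0 : E →L[ℝ] E) ((fun z => e (a⁻¹ * e.symm z)) x) := by
      simp only [hQx]; exact hk0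
    have h2 := h1.comp x hQ.hasFDerivAt
    have h3 : HasFDerivAt (fun z => e (ψ a * e.symm z * a⁻¹))
        (fderiv ℝ (fun z => e (ψ a * e.symm z * a⁻¹)) o) ((k ∘ fun z => e (a⁻¹ * e.symm z)) x) := by
      simp only [Function.comp_apply, hQx, hko]; exact hP.hasFDerivAt
    have h4 := h3.comp x h2
    rw [ContinuousLinearMap.zero_comp, ContinuousLinearMap.comp_zero] at h4
    refine h4.congr_of_eventuallyEq ?_
    have hcx : ContinuousAt e.symm x :=
      (contMDiffAt_extChartAt_symm_comp I contDiffAt_id hx.2).continuousAt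
    have hca : ContinuousAt (fun z => a⁻¹ * e.symm z) x := continuousAt_const.mul hcx
    have hsa : e.source ∈ 𝓝 (a⁻¹ * e.symm x) := by
      change e.source ∈ 𝓝 (a⁻¹ * a)
      rw [inv_mul_cancel]
      exact extChartAt_source_mem_nhds 1
    have hcb : ContinuousAt (fun z => ψ (a⁻¹ * e.symm z) * (a⁻¹ * e.symm z)⁻¹) x :=
      (hψ.continuous.continuousAt.comp hca).mul hca.inv
    have hsb : e.source ∈ 𝓝 (ψ (a⁻¹ * e.symm x) * (a⁻¹ * e.symm x)⁻¹) := by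
      change e.source ∈ 𝓝 (ψ (a⁻¹ * a) * (a⁻¹ * a)⁻¹)
      rw [inv_mul_cancel, map_one, inv_one, mul_one]
      exact extChartAt_source_mem_nhds 1
    filter_upwards [hca.eventually_mem hsa, hcb.eventually_mem hsb] with z hz1 hz2
    simp only [hk, Function.comp_apply]
    rw [e.left_inv hz1, e.left_inv hz2, map_mul, map_inv]
    congr 1
    group
  obtain ⟨δ, hδ0, hδ⟩ := Metric.eventually_nhds_iff_ball.1 (hkx.and hks)
  have hconst : ∀ y ∈ Metric.ball o δ, k y = o := by
    intro y hy
    rw [← hko]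
    exact Metric.isOpen_ball.is_const_of_fderiv_eq_zero (convex_ball o δ).isPreconnected
      (fun z hz => (hδ z hz).1.differentiableAt.differentiableWithinAt)
      (fun z hz => (hδ z hz).1.fderiv) hy (Metric.mem_ball_self hδ0)
  have hfix : ∀ y ∈ Metric.ball o δ, ψ (e.symm y) = e.symm y := by
    intro y hy
    have h1 : e (ψ (e.symm y) * (e.symm y)⁻¹) = e 1 := hconst y hy
    have h2 := e.injOn (hδ y hy).2.1 (one_mem_chart_source I G) h1
    exact mul_inv_eq_one.1 h2
  let S : Subgroup G := ψ.eqLocus (MonoidHom.id G)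
  have hS : (S : Set G) ∈ 𝓝 (1 : G) := by
    have hc1 : ContinuousAt e (1 : G) := continuousAt_extChartAt 1
    filter_upwards [extChartAt_source_mem_nhds (I := I) (1 : G),
      hc1.eventually_mem (Metric.ball_mem_nhds (e 1) hδ0)] with x hx1 hx2
    have h1 := hfix (e x) hx2
    rwa [e.left_inv hx1] at h1
  have hopen : IsOpen (S : Set G) := Subgroup.isOpen_of_mem_nhds S hS
  have htop : (S : Set G) = univ :=
    IsClopen.eq_univ ⟨Subgroup.isClosed_of_isOpen S hopen, hopen⟩ ⟨1, S.one_mem⟩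
  have hg : g ∈ (S : Set G) := by rw [htop]; trivial
  exact hg

end Automorphisms

section Exponential

variable {E : Type*} [NormedAddCommGroup E] [NormedSpace ℝ E]

theorem hasDerivAt_exp_smul_apply [CompleteSpace E] (A : E →L[ℝ] E) (u : E) (t : ℝ) :
    HasDerivAt (fun t : ℝ => NormedSpace.exp (t • A) u) (A (NormedSpace.exp (t • A) u)) t :=
  (hasDerivAt_exp_smul_const' (𝕂 := ℝ) A t).clm_apply (hasDerivAt_const t u) |>.congr_deriv
    (by simp)

theorem exp_smul_apply_exp_neg_smul_apply [CompleteSpace E] (A : E →L[ℝ] E) (t : ℝ) (u : E) :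
    NormedSpace.exp (t • A) (NormedSpace.exp (-(t • A)) u) = u := by
  let _ : NormedAlgebra ℚ (E →L[ℝ] E) := .restrictScalars ℚ ℝ _
  have h := NormedSpace.exp_add_of_commute (Commute.refl (t • A)).neg_right
  rw [add_neg_cancel, NormedSpace.exp_zero] at h
  exact (congrArg (fun L : E →L[ℝ] E => L u) h).symm

theorem skew_of_exp_invariant [FiniteDimensional ℝ E] (B : LinearMap.BilinForm ℝ E)
    (A : E →L[ℝ] E)
    (h : ∀ t : ℝ, 0 ≤ t → ∀ u v, B (NormedSpace.exp (t • A) u) (NormedSpace.exp (t • A) v) = B u v)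
    (u v : E) : B (A u) v = -B u (A v) := by
  have : CompleteSpace E := FiniteDimensional.complete ℝ E
  have h' : ∀ (t : ℝ) (u v : E),
      B (NormedSpace.exp (t • A) u) (NormedSpace.exp (t • A) v) = B u v := by
    intro t u v
    rcases le_total 0 t with ht | ht
    · exact h t ht u v
    · have h1 := h (-t) (by linarith) (NormedSpace.exp (t • A) u) (NormedSpace.exp (t • A) v)
      have h2 (w : E) : NormedSpace.exp ((-t) • A) (NormedSpace.exp (t • A) w) = w := by
        simpa using exp_smul_apply_exp_neg_smul_apply A (-t) w
      rw [h2, h2] at h1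
      exact h1.symm
  have h1 := B.toContinuousBilinearMap.hasFDerivAt_of_bilinear
    (hasDerivAt_exp_smul_apply A u 0).hasFDerivAt (hasDerivAt_exp_smul_apply A v 0).hasFDerivAt
  have h2 : HasFDerivAt (fun t : ℝ => B.toContinuousBilinearMap
      (NormedSpace.exp (t • A) u) (NormedSpace.exp (t • A) v)) (0 : ℝ →L[ℝ] ℝ) 0 := by
    simp only [LinearMap.toContinuousBilinearMap_apply, h']
    exact hasFDerivAt_const _ _
  have h3 := congrArg (fun L : ℝ →L[ℝ] ℝ => L 1) (h1.unique h2)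
  have h4 : B u (A v) + B (A u) v = 0 := by simpa using h3
  linear_combination h4

theorem exp_smul_apply_eq_of_hasDerivAt [CompleteSpace E] {A : E →L[ℝ] E} {c : ℝ → E}
    (hc : ∀ t, HasDerivAt c (A (c t)) t) (t : ℝ) : NormedSpace.exp (t • A) (c 0) = c t := by
  have h := ODE_solution_unique_univ (v := fun _ x => A x) (s := fun _ => univ) (K := ‖A‖₊)
    (f := fun t : ℝ => NormedSpace.exp (t • A) (c 0)) (g := c) (t₀ := 0)
    (fun _ => A.lipschitz.lipschitzOnWith)
    (fun t => ⟨hasDerivAt_exp_smul_apply A (c 0) t, trivial⟩) (fun t => ⟨hc t, trivial⟩) (by simp)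
  exact congrFun h t

theorem exists_exp_smul_eq_id [CompleteSpace E] (A : E →L[ℝ] E) (α : ℝ)
    (h : ∀ v, ∃ v₀ v₁, v = v₀ + v₁ ∧ A v₀ = 0 ∧ A (A v₁) = -(α ^ 2) • v₁ ∧ (α = 0 → v₁ = 0)) :
    ∃ T : ℝ, 0 < T ∧ NormedSpace.exp (T • A) = ContinuousLinearMap.id ℝ E := by
  by_cases hα : α = 0
  · refine ⟨1, one_pos, ?_⟩
    have hA : A = 0 := by
      ext v
      obtain ⟨v₀, v₁, rfl, h0, -, h1⟩ := h v
      rw [h1 hα, add_zero, h0]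
      rfl
    rw [hA, smul_zero, NormedSpace.exp_zero]
    rfl
  · refine ⟨2 * Real.pi / |α|, by positivity, ?_⟩
    ext v
    obtain ⟨v₀, v₁, rfl, h0, h1, -⟩ := h v
    let c : ℝ → E := fun t => v₀ + (Real.cos (α * t) • v₁ + (Real.sin (α * t) / α) • A v₁)
    have hc : ∀ t, HasDerivAt c (A (c t)) t := by
      intro t
      have hm : HasDerivAt (fun t => α * t) α t := by simpa using (hasDerivAt_id t).const_mul α
      have hd := (((hm.cos.smul_const v₁).add ((hm.sin.div_const α).smul_const
        (A v₁))).const_add v₀)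
      refine hd.congr_deriv ?_
      simp only [c, map_add, map_smul, h0, h1, smul_smul, zero_add]
      rw [add_comm]
      congr 2
      · field_simp
      · field_simp
    have h2 := exp_smul_apply_eq_of_hasDerivAt hc (2 * Real.pi / |α|)
    have hc0 : c 0 = v₀ + v₁ := by simp [c]
    have hT : c (2 * Real.pi / |α|) = v₀ + v₁ := by
      rcases abs_choice α with h | h
      · have h3 : α * (2 * Real.pi / |α|) = 2 * Real.pi := by rw [h]; field_simp
        simp [c, h3]
      · have h3 : α * (2 * Real.pi / |α|) = -(2 * Real.pi) := by rw [h]; field_simp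
        simp [c, h3]
    rw [hc0, hT] at h2
    exact h2

end Exponential

theorem IsLieGroupAutomorphism.exists_monoidHom {E : Type*} [NormedAddCommGroup E]
    [NormedSpace ℝ E] {H : Type*} [TopologicalSpace H] {I : ModelWithCorners ℝ E H}
    {G : Type*} [TopologicalSpace G] [ChartedSpace H G] [Group G]
    {f : G → G} (hf : IsLieGroupAutomorphism I f) :
    ∃ ψ : G →* G, ⇑ψ = f ∧ ContMDiff I I ∞ ψ := by
  obtain ⟨e, he, h, -⟩ := hf
  exact ⟨e.toMonoidHom, funext he, h⟩

section LinearVectorFields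

variable {E : Type*} [NormedAddCommGroup E] [NormedSpace ℝ E]
  {H : Type*} [TopologicalSpace H] (I : ModelWithCorners ℝ E H)
  {G : Type*} [TopologicalSpace G] [ChartedSpace H G] [Group G] [LieGroup I ∞ G]
  [BoundarylessManifold I G]

theorem derivationOf_apply_of_eq_zero [CompleteSpace E] {X : (g : G) → TangentSpace I g}
    (h0 : X 1 = 0) (Y : GroupLieAlgebra I G) :
    derivationOf I X Y = fderiv ℝ (chartField I (1 : G) X) (chartOne I G) Y := by
  change -VectorField.mlieBracket I X (mulInvariantVectorField Y) (1 : G) = _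
  rw [mlieBracket_eq_chartField, h0, mulInvariantVectorField_one]
  erw [map_zero, zero_sub, neg_neg]
  rfl

variable [T2Space G] {X : (g : G) → TangentSpace I g} {φ : ℝ → G → G}

theorem IsLinearVectorField.isLieGroupAutomorphism_flow [CompleteSpace E]
    (hX : IsLinearVectorField I X) (hφ : IsFlowOf I X φ) (t : ℝ) :
    IsLieGroupAutomorphism I (φ t) := by
  have : IsManifold I 1 G := IsManifold.of_le (n := ∞) (by simp)
  obtain ⟨φ', hφ', h⟩ := hX.exists_flow
  have h1 : φ = φ' := by
    ext t g
    exact congrFun (isMIntegralCurve_Ioo_eq_of_contMDiff_boundaryless (t₀ := 0)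
      (hX.contMDiff.of_le (by simp)) (hφ.isMIntegralCurve g) (hφ'.isMIntegralCurve g)
      (by rw [hφ.zero_apply, hφ'.zero_apply])) t
  rw [h1]
  exact h t

theorem IsLinearVectorField.flow_apply_one [CompleteSpace E]
    (hX : IsLinearVectorField I X) (hφ : IsFlowOf I X φ) (t : ℝ) : φ t 1 = 1 := by
  obtain ⟨ψ, hψ, -⟩ := (hX.isLieGroupAutomorphism_flow I hφ t).exists_monoidHom
  rw [← hψ, map_one]

theorem IsLinearVectorField.apply_one [CompleteSpace E]
    (hX : IsLinearVectorField I X) (hφ : IsFlowOf I X φ) : X 1 = 0 := by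
  have h1 := hX.flow_apply_one I hφ
  have h2 := IsMIntegralCurve.hasDerivAt_chart I (hφ.isMIntegralCurve (1 : G)) 1 (t := 0)
    (by rw [h1]; exact one_mem_chart_source I G)
  simp only [h1] at h2
  exact (chartField_self I (1 : G) X).symm.trans (h2.unique (hasDerivAt_const _ _))

variable [FiniteDimensional ℝ E]

theorem IsLinearVectorField.fderiv_flow [CompleteSpace E]
    (hX : IsLinearVectorField I X) (hφ : IsFlowOf I X φ) {t : ℝ} (ht : 0 ≤ t) :
    fderiv ℝ (chartMap I (φ t)) (chartOne I G) =
      NormedSpace.exp (t • fderiv ℝ (chartField I (1 : G) X) (chartOne I G)) := by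
  have h1 := hX.flow_apply_one I hφ
  exact (hasFDerivAt_flow I ((hX.contMDiff.mdifferentiable (by simp)) (1 : G)) hφ h1 ht).fderiv

theorem IsLinearVectorField.killingForm_skew [CompleteSpace E]
    (hX : IsLinearVectorField I X) (hφ : IsFlowOf I X φ) (u v : GroupLieAlgebra I G) :
    killingForm ℝ (GroupLieAlgebra I G) (derivationOf I X u) v =
      -killingForm ℝ (GroupLieAlgebra I G) u (derivationOf I X v) := by
  set A := fderiv ℝ (chartField I (1 : G) X) (chartOne I G)
  have hinv : ∀ t : ℝ, 0 ≤ t → ∀ u v : E,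
      killingForm ℝ (GroupLieAlgebra I G) (NormedSpace.exp (t • A) u) (NormedSpace.exp (t • A) v) =
        killingForm ℝ (GroupLieAlgebra I G) u v := by
    intro t ht u v
    obtain ⟨ψ, hψ, hs⟩ := (hX.isLieGroupAutomorphism_flow I hφ t).exists_monoidHom
    have hL : fderiv ℝ (chartMap I ψ) (chartOne I G) = NormedSpace.exp (t • A) := by
      rw [hψ]; exact hX.fderiv_flow I hφ ht
    have hb (Y Z : E) := fderiv_chartMap_bracket I hs Y Z
    rw [hL] at hb
    have hl (u : E) : NormedSpace.exp (-(t • A)) (NormedSpace.exp (t • A) u) = u := by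
      simpa using exp_smul_apply_exp_neg_smul_apply A (-t) u
    let e : GroupLieAlgebra I G ≃ₗ⁅ℝ⁆ GroupLieAlgebra I G :=
      { toFun := fun u => NormedSpace.exp (t • A) (show E from u)
        map_add' := fun u v => map_add (NormedSpace.exp (t • A)) (show E from u) (show E from v)
        map_smul' := fun c u => map_smul (NormedSpace.exp (t • A)) c (show E from u)
        map_lie' := fun {Y Z} =>
          (congrArg (fun w : E => NormedSpace.exp (t • A) w) (bracket_eq_mixedDeriv I G Y Z)).trans
            ((hb Y Z).trans (bracket_eq_mixedDeriv I G (NormedSpace.exp (t • A) (show E from Y))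
              (NormedSpace.exp (t • A) (show E from Z))).symm)
        invFun := fun u => NormedSpace.exp (-(t • A)) (show E from u)
        left_inv := fun u => hl u
        right_inv := fun u => exp_smul_apply_exp_neg_smul_apply A t u }
    exact LieAlgebra.killingForm_of_equiv_apply e u v
  have h := skew_of_exp_invariant (E := E) (killingForm ℝ (GroupLieAlgebra I G)) A hinv u v
  rw [derivationOf_apply_of_eq_zero I (hX.apply_one I hφ),
    derivationOf_apply_of_eq_zero I (hX.apply_one I hφ)]
  exact h

/-- If the nonzero eigenvalues of the derivation of a linear vector field on a connected compact
semisimple Lie group are `±αi`, then the flow is periodic. -/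
theorem IsLinearVectorField.exists_flow_eq_id [CompleteSpace E] [ConnectedSpace G] [CompactSpace G]
    (hG : IsSemisimpleLieGroup I G)
    (hX : IsLinearVectorField I X) (hφ : IsFlowOf I X φ) (α : ℝ)
    (hα : ∀ μ : ℂ, IsComplexEigenvalue (derivationOf I X) μ →
      μ = 0 ∨ μ = α * Complex.I ∨ μ = -(α * Complex.I)) :
    ∃ T : ℝ, 0 < T ∧ ∀ g, φ T g = g := by
  have hfd : FiniteDimensional ℝ (GroupLieAlgebra I G) := inferInstanceAs (FiniteDimensional ℝ E)
  have hdec := exists_decomposition_of_skew (V := GroupLieAlgebra I G)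
    (B := -killingForm ℝ (GroupLieAlgebra I G)) (S := derivationOf I X)
    (fun u v => congrArg Neg.neg (LieModule.traceForm_comm ℝ _ _ u v))
    (fun v hv => neg_pos.2 (killingForm_neg I G hG v hv))
    (fun u v => congrArg Neg.neg (hX.killingForm_skew I hφ u v)) α hα
  have hD := derivationOf_apply_of_eq_zero I (hX.apply_one I hφ)
  obtain ⟨T, hT, hexp⟩ := exists_exp_smul_eq_id
    (fderiv ℝ (chartField I (1 : G) X) (chartOne I G)) α (fun v => by
      obtain ⟨v₀, v₁, h, h0, h1, h2⟩ := hdec v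
      rw [hD] at h0
      rw [hD, hD] at h1
      exact ⟨v₀, v₁, h, h0, h1, h2⟩)
  obtain ⟨ψ, hψ, hs⟩ := (hX.isLieGroupAutomorphism_flow I hφ T).exists_monoidHom
  refine ⟨T, hT, fun g => ?_⟩
  rw [← hψ]
  refine eq_id_of_fderiv_chartMap_eq_id I hs ?_ g
  rw [hψ, hX.fderiv_flow I hφ hT.le, hexp]

end LinearVectorFields

theorem omegaLimit_eq_range_of_periodic {M : Type*} [TopologicalSpace M] [T2Space M]
    {φ : ℝ → M → M} {g : M} {T : ℝ} (hT : 0 < T) (hc : Continuous fun t => φ t g)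
    (hp : Function.Periodic (fun t => φ t g) T) :
    omegaLimit atTop φ {g} = range fun t => φ t g := by
  have hcl : IsClosed (range fun t => φ t g) := by
    rw [← hp.image_Icc hT 0]
    exact (isCompact_Icc.image hc).isClosed
  have him : ∀ u ∈ (atTop : Filter ℝ), image2 φ u {g} = range fun t => φ t g := by
    intro u hu
    rw [image2_singleton_right]
    refine Subset.antisymm (image_subset_range _ _) ?_
    rintro _ ⟨t, rfl⟩
    obtain ⟨a, ha⟩ := mem_atTop_sets.1 hu
    obtain ⟨n, hn⟩ := exists_nat_gt ((a - t) / T)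
    rw [div_lt_iff₀ hT] at hn
    refine ⟨t + n * T, ha _ (by linarith), hp.nat_mul n t⟩
  refine Subset.antisymm ?_ ?_
  · refine (iInter₂_subset univ univ_mem).trans ?_
    rw [him univ univ_mem, hcl.closure_eq]
  · refine subset_iInter₂ fun u hu => ?_
    rw [him u hu]
    exact subset_closure

end LinearFlow

theorem mainTheorem5
    {E : Type*} [NormedAddCommGroup E] [NormedSpace ℝ E] [FiniteDimensional ℝ E] [CompleteSpace E]
    {H : Type*} [TopologicalSpace H] (I : ModelWithCorners ℝ E H)
    {G : Type*} [TopologicalSpace G] [ChartedSpace H G] [Group G] [LieGroup I ∞ G]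
    [BoundarylessManifold I G] [T2Space G] [ConnectedSpace G] [CompactSpace G]
    (hG : LinearFlow.IsSemisimpleLieGroup I G)
    (X : (g : G) → TangentSpace I g) (hX : LinearFlow.IsLinearVectorField I X)
    (φ : ℝ → G → G) (hφ : LinearFlow.IsFlowOf I X φ)
    (α : ℝ)
    (hα : ∀ μ : ℂ, LinearFlow.IsComplexEigenvalue (LinearFlow.derivationOf I X) μ →
      μ = 0 ∨ μ = α * Complex.I ∨ μ = -(α * Complex.I))
    (g : G) (Ω : Set G) (hΩ : Ω = omegaLimit Filter.atTop φ {g})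
    (hne : Ω.Nonempty) (hcpt : IsCompact Ω)
    (hfix : ∀ x ∈ Ω, ¬ LinearFlow.IsFixedPoint φ x) :
    LinearFlow.IsPeriodicOrbit φ Ω := by
  have : IsManifold I 1 G := IsManifold.of_le (n := ∞) (by simp)
  obtain ⟨T, hT, hid⟩ := hX.exists_flow_eq_id I hG hφ α hα
  have hper : Function.Periodic (fun t => φ t g) T := by
    have h := (hφ.isMIntegralCurve g).periodic_of_eq (a := T) (b := 0)
      (hX.contMDiff.of_le (by simp)) (by simp only [hid, hφ.zero_apply])
    rwa [sub_zero] at h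
  have hΩ' : Ω = Set.range fun t => φ t g :=
    hΩ.trans (LinearFlow.omegaLimit_eq_range_of_periodic hT (hφ.isMIntegralCurve g).continuous hper)
  refine ⟨g, hfix g ?_, ⟨T, hT, hper⟩, hΩ'⟩
  rw [hΩ']
  exact ⟨0, hφ.zero_apply g⟩
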